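/- **Lifting lemma for Gaussian unitaries.** *Setting.* Let $G(A,B)$, for $A,B\in U(2)$ with $\det A=\det B$, be the two-qubit matchgate that acts as $A$ on $\mathrm{span}\{|00\rangle,|11\rangle\}$ and as $B$ on $\mathrm{span}\{|01\rangle,|10\rangle\}$. Let $G_n$, the set of $n$-qubit Gaussian unitaries, be the group generated by the nearest-neighbour matchgates $G(A,B)_{j,j+1}$ ($1\le j\le n-1$) and the Pauli gates $X_j,Y_j$ ($1\le j\le n$), and let $\mathcal G_n=\{U|0\rangle^{\otimes n}: U\in G_n\}$ be the set of Gaussian states. For an $n$-qubit state $|\psi\rangle$ and an $n$-qubit unitary $U$ define $$\xi(|\psi\rangle)=\inf\Big\{\|c\|_1^2 : |\psi\rangle=\sum_{j=1}^{\chi} c_j|\phi_j\rangle,\ |\phi_j\rangle\in\mathcal G_n,\ c_j\in\mathbb C,\ \chi\in\mathbb N\Big\},$$ $$\xi(U)=\inf\Big\{\|c\|_1^2 : U=\sum_{j=1}^{\chi} c_jK_j,\ K_j\in G_n,\ c_j\in\mathbb C,\ \chi\in\mathbb N\Big\},$$ where $\|c\|_1=\sum_j|c_j|$. Let $|\psi^+\rangle=(|00\rangle+|11\rangle)/\sqrt2$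 and $|g\rangle=|\psi^+\rangle\otimes|\psi^+\rangle$. *Statement.* Let $V$ be a two-qubit fermionic unitary, i.e. a unitary with $[V,Z\otimes Z]=0$, and let $c_1,\dots,c_\chi\in\mathbb C$ and Gaussian unitaries $K_1,\dots,K_\chi\in G_2$ satisfy $$|v\rangle:=(I\otimes V\otimes I)|g\rangle=\sum_{j=1}^{\chi}c_j\,(I\otimes K_j\otimes I)|g\rangle .$$ Then: 1. $V=\sum_{j=1}^{\chi}c_jK_j$, and for every integer $t\ge 0$ we have $V^{\otimes t}=\big(\sum_{j=1}^{\chi}c_jK_j\big)^{\otimes t}$ and $\xi(V^{\otimes t})\le\|c\|_1^{2t}$. Here $V^{\otimes t}$ is regarded as a $2t$-qubit unitary whose $k$-th factor acts on the adjacent qubits $2k-1,2k$. 2. If the decomposition of $|v\rangle$ is optimal for the state extent, i.e. $\xi(|v\rangle)=\|c\|_1^2$, then $\xi(V)=\xi(|v\rangle)$, and $\xi(V^{\otimes t})=\xi(V)^t$ for every integer $t\ge0$. -/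

import Mathlib

open scoped BigOperators

namespace FermionicExtent

/-- Computational basis labels of `n` qubits; index `0` is the first (leftmost) tensor factor. -/
abbrev Bits (n : ℕ) := Fin n → Fin 2

/-- Vectors of the `n`-qubit space `(ℂ²)^{⊗ n}`, written in the computational basis. -/
abbrev QState (n : ℕ) := Bits n → ℂ

/-- Operators on `n` qubits, written in the computational basis. -/
abbrev QOp (n : ℕ) := Matrix (Bits n) (Bits n) ℂ

/-- The operator on `n` qubits that acts with `U` on the qubits `f 0, f 1, …` (in this order) and
as the identity on all other qubits. It is only used for injective `f`. -/
def onQubits {m n : ℕ} (f : Fin m → Fin n) (U : QOp m) : QOp n := fun x y =>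
  if ∀ i, (∀ k, f k ≠ i) → x i = y i then U (fun k => x (f k)) (fun k => y (f k)) else 0

/-- A `2 × 2` matrix as an operator on one qubit. -/
def oneQubit (A : Matrix (Fin 2) (Fin 2) ℂ) : QOp 1 := fun x y => A (x 0) (y 0)

def pauliX : Matrix (Fin 2) (Fin 2) ℂ := !![0, 1; 1, 0]

noncomputable def pauliY : Matrix (Fin 2) (Fin 2) ℂ := !![0, -Complex.I; Complex.I, 0]

/-- The two-qubit gate `G(A, B)`: `A` acts on the span of `|00⟩, |11⟩`, and `B` acts on the span
of `|01⟩, |10⟩`. -/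
def matchgate (A B : Matrix (Fin 2) (Fin 2) ℂ) : QOp 2 := fun x y =>
  if x 0 = x 1 ∧ y 0 = y 1 then A (x 0) (y 0)
  else if x 0 ≠ x 1 ∧ y 0 ≠ y 1 then B (x 0) (y 0)
  else 0

/-- The generating gates: nearest neighbour matchgates, and `X_j`, `Y_j` for every qubit `j`. -/
def gaussianGates (n : ℕ) : Set (QOp n) :=
  {U | ∃ (j k : Fin n) (A B : Matrix (Fin 2) (Fin 2) ℂ), (k : ℕ) = (j : ℕ) + 1 ∧
      A ∈ Matrix.unitaryGroup (Fin 2) ℂ ∧ B ∈ Matrix.unitaryGroup (Fin 2) ℂ ∧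
      A.det = B.det ∧ U = onQubits ![j, k] (matchgate A B)} ∪
  {U | ∃ j : Fin n, U = onQubits ![j] (oneQubit pauliX) ∨ U = onQubits ![j] (oneQubit pauliY)}

/-- The Gaussian unitaries `G_n`: all finite products (circuits) of generating gates. The set of
generating gates is closed under inverses, so this is also the group that they generate. -/
def gaussianUnitaries (n : ℕ) : Submonoid (QOp n) := Submonoid.closure (gaussianGates n)

/-- The state `|0⟩^{⊗ n}`. -/
def zeroState (n : ℕ) : QState n := fun x => if x = 0 then 1 else 0

/-- The pure Gaussian states `U |0⟩^{⊗ n}` with `U ∈ G_n`. -/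
def gaussianStates (n : ℕ) : Set (QState n) :=
  {φ | ∃ U ∈ gaussianUnitaries n, φ = U.mulVec (zeroState n)}

/-- The pure state extent: the least `‖c‖₁²` over all finite decompositions `ψ = ∑ j, c j • φ j`
into Gaussian states. -/
noncomputable def stateExtent {n : ℕ} (ψ : QState n) : ℝ :=
  sInf {r | ∃ (χ : ℕ) (c : Fin χ → ℂ) (φ : Fin χ → QState n),
    (∀ j, φ j ∈ gaussianStates n) ∧ ψ = ∑ j, c j • φ j ∧ r = (∑ j, ‖c j‖) ^ 2}

/-- The unitary extent: the least `‖c‖₁²` over all finite decompositions `U = ∑ j, c j • K j`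
into Gaussian unitaries. -/
noncomputable def unitaryExtent {n : ℕ} (U : QOp n) : ℝ :=
  sInf {r | ∃ (χ : ℕ) (c : Fin χ → ℂ) (K : Fin χ → QOp n),
    (∀ j, K j ∈ gaussianUnitaries n) ∧ U = ∑ j, c j • K j ∧ r = (∑ j, ‖c j‖) ^ 2}

/-- The parity operator `Z^{⊗ n}`. -/
def parityOp (n : ℕ) : QOp n := Matrix.diagonal fun x => ∏ i, (-1 : ℂ) ^ (x i : ℕ)

/-- `U` is a fermionic unitary: it is unitary and commutes with the parity operator. -/
def IsFermionicUnitary {n : ℕ} (U : QOp n) : Prop :=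
  U ∈ Matrix.unitaryGroup (Bits n) ℂ ∧ U * parityOp n = parityOp n * U

/-- `|ψ⁺⟩ = (|00⟩ + |11⟩) / √2`. -/
noncomputable def psiPlus : QState 2 := fun x => if x 0 = x 1 then 1 / (Real.sqrt 2 : ℂ) else 0

/-- The four-qubit state `|g⟩ = |ψ⁺⟩ ⊗ |ψ⁺⟩`. -/
noncomputable def psiPlusPair : QState 4 := fun x => psiPlus ![x 0, x 1] * psiPlus ![x 2, x 3]

/-- The Choi state `(I ⊗ W ⊗ I) (|ψ⁺⟩ ⊗ |ψ⁺⟩)`, where `W` acts on the two middle qubits. -/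
noncomputable def choiState (W : QOp 2) : QState 4 := (onQubits ![1, 2] W).mulVec psiPlusPair

/-- The tensor power `U^{⊗ t}`: the `k`-th copy of `U` acts on the `k`-th block of `m`
consecutive qubits (`finProdFinEquiv (k, i)` is qubit number `m * k + i`). -/
def tensorPow {m : ℕ} (U : QOp m) (t : ℕ) : QOp (t * m) := fun x y =>
  ∏ k : Fin t, U (fun i => x (finProdFinEquiv (k, i))) (fun i => y (finProdFinEquiv (k, i)))

end FermionicExtent

/-!
The proof reduces the multiplicativity of the extent to a bound on overlaps with Gaussian
unitaries.

The Choi state of `W` has the entries of `W / 2` as amplitudes (`choiState_apply`), so a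
decomposition of the Choi state of `V` is a decomposition of `V`. Since Choi states of Gaussian
unitaries are Gaussian, decompositions also pass in the other direction, and the two extents
agree. Expanding a tensor power of a decomposition gives the upper bounds for tensor powers.

For the lower bounds, a two-qubit fermionic unitary is, up to a matchgate, `cos θ + i sin θ Z ⊗ Z`
with `|θ| ≤ π / 4` (`IsFermionicUnitary.exists_normalForm`), which visibly has a decomposition of
weight `μ = cos θ + |sin θ|`. The dual witness is `W = 1 - i s Z ⊗ Z`, where `s = ±1` is the sign
of `sin θ`: its trace against the normal form is `4 μ`, and the trace of its `t`-th tensor power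
against any Gaussian unitary `K` on `2 t` qubits has modulus at most `4 ^ t`
(`norm_trace_tensorPow_witness_le`). Hence every decomposition of the `t`-th tensor power has
weight at least `μ ^ t`.

The last bound is the core (`IsMajoranaBlocks.norm_trace_witness_mul_le`). On two copies of the
system, the operators `A i = c i ⊗ conj (c i)`, for Majorana operators `c i`, are commuting
involutions. As `K` rotates the Majorana operators by a real orthogonal matrix, `K ⊗ conj K`
commutes with `Λ = ∑ i, A i` (`commute_pairing_of_mem_gaussianUnitaries`), and therefore also with
`exp (i π / 8 Λ)`. The squared modulus of the trace of `W ^ ⊗ t * K` is the trace of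
`(W ⊗ conj W) ^ ⊗ t * (K ⊗ conj K)`, and the first factor may be conjugated by this exponential.
For a block with parity `P`, the conjugation replaces the part of `W ⊗ conj W` that mixes `1` and
`P` by a combination of terms `c i ⊗ conj (P * c i)` and `P * c i ⊗ conj (c i)` with coefficients
`± 1 / 2`, and keeps `1 ⊗ 1 + P ⊗ P` (`exp_conj_block`, `IsMajoranaBlocks.conj_witness_eq_sum`).
After expansion over all blocks, each copy carries every Majorana monomial at most once, with a
coefficient of modulus at most one. The Cauchy–Schwarz inequality and Bessel's inequality for
trace-orthogonal unitaries then bound the sum by `(4 ^ t) ^ 2`.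
-/

open scoped BigOperators

namespace FermionicExtent

/-! ### The conjugating exponential -/

open NormedSpace in
/-- The exponential acts on an eigenvector of left multiplication by the exponential of the
eigenvalue. -/
theorem exp_mul_of_eigen {R : Type*} [NormedRing R] [NormedAlgebra ℂ R] [CompleteSpace R]
    {a b : R} {z : ℂ} (h : a * b = z • b) : exp a * b = Complex.exp z • b := by
  let : NormedAlgebra ℚ R := NormedAlgebra.restrictScalars ℚ ℂ R
  have hpow : ∀ k : ℕ, a ^ k * b = z ^ k • b := by
    intro k
    induction k with
    | zero => simp
    | succ k ih => rw [pow_succ, mul_assoc, h, mul_smul_comm, ih, smul_smul, pow_succ, mul_comm]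
  have h1 := (exp_series_hasSum_exp' (𝕂 := ℂ) a).mul_right b
  have h2 := (exp_series_hasSum_exp' (𝕂 := ℂ) z).smul_const b
  rw [Complex.exp_eq_exp_ℂ]
  refine h1.unique ?_
  have h3 : (fun k : ℕ => ((k.factorial : ℂ)⁻¹ • a ^ k) * b) =
      fun k : ℕ => ((k.factorial : ℂ)⁻¹ • z ^ k) • b := by
    funext k
    rw [smul_mul_assoc, hpow, smul_smul, smul_eq_mul]
  rw [h3]
  exact h2

open NormedSpace in
/-- Conjugation by `exp (iπ/8 • Λ)`. If `Q` shifts `Λ` by `-2σ`, and `σ²` equals `4` where the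
involution `E` equals `-1`, then conjugation turns `i Q (1 - E)` into `½ Q σ (1 - E)` and leaves
`1 + E` alone. -/
theorem exp_conj_block {R : Type*} [NormedRing R] [NormedAlgebra ℂ R] [CompleteSpace R]
    {Λ σ Q E : R} (hΛQ : Λ * Q = Q * (Λ - (2 : ℂ) • σ)) (hΛσ : Commute Λ σ)
    (hE : Commute Λ E) (hσ : σ * σ * (1 - E) = (4 : ℂ) • (1 - E)) (s : ℂ) :
    exp ((Complex.I * (Real.pi / 8)) • Λ) * (1 + E + (Complex.I * s) • (Q * (1 - E))) =
      (1 + E + (s / 2) • (Q * σ * (1 - E))) * exp ((Complex.I * (Real.pi / 8)) • Λ) := by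
  let : NormedAlgebra ℚ R := NormedAlgebra.restrictScalars ℚ ℂ R
  set w : ℂ := Complex.I * (Real.pi / 8) with hw
  have hVE : Commute (exp (w • Λ)) E := (hE.symm.smul_right w).exp_right.symm
  have hVQ : exp (w • Λ) * Q = Q * (exp ((-2 * w) • σ) * exp (w • Λ)) := by
    have h1 : SemiconjBy Q ((-2 * w) • σ + w • Λ) (w • Λ) := by
      have h2 : (-2 * w) • σ + w • Λ = w • (Λ - (2 : ℂ) • σ) := by module
      rw [SemiconjBy, h2, mul_smul_comm, ← hΛQ, smul_mul_assoc]
    rw [← h1.exp_right.eq, exp_add_of_commute ((hΛσ.symm.smul_left _).smul_right _)]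
  have hexp : exp ((-2 * w) • σ) * (1 - E) = (-Complex.I / 2) • (σ * (1 - E)) := by
    set b := 1 - E
    have e1 : ((-2 * w) • σ) * ((2 : ℂ) • b + σ * b) = (-4 * w) • ((2 : ℂ) • b + σ * b) := by
      rw [smul_mul_assoc, mul_add, ← mul_assoc σ σ, hσ, mul_smul_comm]; module
    have e2 : ((-2 * w) • σ) * ((2 : ℂ) • b - σ * b) = (4 * w) • ((2 : ℂ) • b - σ * b) := by
      rw [smul_mul_assoc, mul_sub, ← mul_assoc σ σ, hσ, mul_smul_comm]; module
    have f1 := exp_mul_of_eigen e1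
    have f2 := exp_mul_of_eigen e2
    have g1 : Complex.exp (-4 * w) = -Complex.I := by
      rw [show -4 * w = -(Real.pi / 2 * Complex.I) by rw [hw]; ring, Complex.exp_neg,
        Complex.exp_pi_div_two_mul_I, Complex.inv_I]
    have g2 : Complex.exp (4 * w) = Complex.I := by
      rw [show 4 * w = Real.pi / 2 * Complex.I by rw [hw]; ring, Complex.exp_pi_div_two_mul_I]
    have h5 : b = (1 / 4 : ℂ) • (((2 : ℂ) • b + σ * b) + ((2 : ℂ) • b - σ * b)) := by module
    conv_lhs => rw [h5]
    rw [mul_smul_comm, mul_add, f1, f2, g1, g2]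
    module
  have hV1 : Commute (exp (w • Λ)) (1 - E) := (Commute.one_right _).sub_right hVE
  have hVQE : exp (w • Λ) * (Q * (1 - E)) =
      (-Complex.I / 2) • (Q * σ * (1 - E) * exp (w • Λ)) := by
    rw [← mul_assoc, hVQ, mul_assoc, mul_assoc, hV1.eq, ← mul_assoc (exp _) (1 - E), hexp]
    simp only [smul_mul_assoc, mul_smul_comm, mul_assoc]
  rw [mul_add, mul_smul_comm, hVQE, ((Commute.one_right _).add_right hVE).eq, 
    add_mul (1 + E), smul_mul_assoc, smul_smul]
  congr 2
  linear_combination (-s / 2) * Complex.I_mul_I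

/-- One invertible element `V` conjugates all blocks at once as in `exp_conj_block`, and commutes
with everything that commutes with `Λ`. -/
theorem exists_conj_blocks {R ι : Type*} [NormedRing R] [NormedAlgebra ℂ R] [CompleteSpace R]
    {Λ : R} {σ Q E : ι → R} (hΛQ : ∀ b, Λ * Q b = Q b * (Λ - (2 : ℂ) • σ b))
    (hΛσ : ∀ b, Commute Λ (σ b)) (hE : ∀ b, Commute Λ (E b))
    (hσ : ∀ b, σ b * σ b * (1 - E b) = (4 : ℂ) • (1 - E b)) (s : ℂ) :
    ∃ V V' : R, V' * V = 1 ∧ (∀ Y, Commute Λ Y → Commute V Y) ∧ ∀ b,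
      V * (1 + E b + (Complex.I * s) • (Q b * (1 - E b))) =
        (1 + E b + (s / 2) • (Q b * σ b * (1 - E b))) * V := by
  let : NormedAlgebra ℚ R := NormedAlgebra.restrictScalars ℚ ℂ R
  set w : R := (Complex.I * (Real.pi / 8)) • Λ with hw
  refine ⟨NormedSpace.exp w, NormedSpace.exp (-w), ?_, fun Y hY => ?_, fun b => ?_⟩
  · rw [← NormedSpace.exp_add_of_commute (Commute.refl w).neg_left, neg_add_cancel,
      NormedSpace.exp_zero]
  · exact ((hY.symm.smul_right _).exp_right).symm
  · exact exp_conj_block (hΛQ b) (hΛσ b) (hE b) (hσ b) s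

/-- Four commuting involutions with product `-1` have a sum whose square is `4`: three of them
agree and the fourth differs. -/
theorem sum_sq_mul_one_sub_prod {R : Type*} [Ring R] [Algebra ℂ R] {a b c d : R}
    (ha : a * a = 1) (hb : b * b = 1) (hc : c * c = 1) (hd : d * d = 1)
    (hab : Commute a b) (hac : Commute a c) (had : Commute a d) (hbc : Commute b c)
    (hbd : Commute b d) (hcd : Commute c d) :
    (a + b + c + d) * (a + b + c + d) * (1 - a * b * c * d) =
      (4 : ℂ) • (1 - a * b * c * d) := by
  have ha' : ∀ x, a * (a * x) = x := fun x => by rw [← mul_assoc, ha, one_mul]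
  have hb' : ∀ x, b * (b * x) = x := fun x => by rw [← mul_assoc, hb, one_mul]
  have hc' : ∀ x, c * (c * x) = x := fun x => by rw [← mul_assoc, hc, one_mul]
  have hba := hab.eq.symm
  have hca := hac.eq.symm
  have hda := had.eq.symm
  have hcb := hbc.eq.symm
  have hdb := hbd.eq.symm
  have hdc := hcd.eq.symm
  have hba' : ∀ x, b * (a * x) = a * (b * x) := fun x => by rw [← mul_assoc, hba, mul_assoc]
  have hca' : ∀ x, c * (a * x) = a * (c * x) := fun x => by rw [← mul_assoc, hca, mul_assoc]
  have hda' : ∀ x, d * (a * x) = a * (d * x) := fun x => by rw [← mul_assoc, hda, mul_assoc]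
  have hcb' : ∀ x, c * (b * x) = b * (c * x) := fun x => by rw [← mul_assoc, hcb, mul_assoc]
  have hdb' : ∀ x, d * (b * x) = b * (d * x) := fun x => by rw [← mul_assoc, hdb, mul_assoc]
  have hdc' : ∀ x, d * (c * x) = c * (d * x) := fun x => by rw [← mul_assoc, hdc, mul_assoc]
  simp only [mul_add, add_mul, mul_sub, mul_one, one_mul, mul_assoc, ha, hb, hc, hd, ha', hb', hc',
    hba, hca, hda, hcb, hdb, hdc, hba', hca', hda', hcb', hdb', hdc']
  module

/-! ### Two copies of the system -/

section Doubling

open scoped Kronecker Matrix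

variable {X : Type*}

/-- The operator `A ⊗ conj B` on two copies of the system. -/
def dbl (A B : Matrix X X ℂ) : Matrix (X × X) (X × X) ℂ := A ⊗ₖ B.map star

theorem dbl_apply (A B : Matrix X X ℂ) (p q : X × X) :
    dbl A B p q = A p.1 q.1 * star (B p.2 q.2) := rfl

theorem dbl_mul [Fintype X] (A B C D : Matrix X X ℂ) : dbl A B * dbl C D = dbl (A * C) (B * D) := by
  have h : (B * D).map star = B.map star * D.map star := by
    ext i j
    simp [Matrix.mul_apply]
  rw [dbl, dbl, dbl, h, Matrix.mul_kronecker_mul]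

theorem dbl_one [DecidableEq X] : dbl (1 : Matrix X X ℂ) 1 = 1 := by
  rw [dbl, Matrix.map_one star (star_zero _) (star_one _), Matrix.one_kronecker_one]

theorem dbl_neg_neg (A B : Matrix X X ℂ) : dbl (-A) (-B) = dbl A B := by
  ext p q; simp [dbl_apply]

theorem dbl_neg_left (A B : Matrix X X ℂ) : dbl (-A) B = -dbl A B := by
  ext p q; simp [dbl_apply]

theorem dbl_neg_right (A B : Matrix X X ℂ) : dbl A (-B) = -dbl A B := by
  ext p q; simp [dbl_apply]

theorem trace_dbl [Fintype X] (A B : Matrix X X ℂ) : (dbl A B).trace = A.trace * star B.trace := by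
  rw [dbl, Matrix.trace_kronecker]
  simp [Matrix.trace]

theorem list_prod_dbl [Fintype X] [DecidableEq X] {ι : Type*} (l : List ι)
    (f g : ι → Matrix X X ℂ) :
    (l.map fun i => dbl (f i) (g i)).prod = dbl (l.map f).prod (l.map g).prod := by
  induction l with
  | nil => simp [dbl_one]
  | cons a l ih => simp only [List.map_cons, List.prod_cons, ih, dbl_mul]

/-- **Bessel's inequality** for a unitary and a trace-orthogonal family of unitaries. -/
theorem sum_norm_trace_sq_le [Fintype X] [DecidableEq X] {T : Type*} [Fintype T]
    (x : T → Matrix X X ℂ) (K : Matrix X X ℂ) (hx : ∀ τ, x τ * (x τ)ᴴ = 1) (hK : Kᴴ * K = 1)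
    (horth : ∀ τ τ', τ ≠ τ' → (x τ * (x τ')ᴴ).trace = 0) :
    ∑ τ, ‖(x τ * K).trace‖ ^ 2 ≤ (Fintype.card X : ℝ) ^ 2 := by
  classical
  rcases isEmpty_or_nonempty X with h | h
  · simp [Matrix.trace]
  set D : ℝ := (Fintype.card X : ℝ) with hD
  have hD0 : 0 < D := by rw [hD]; exact_mod_cast Fintype.card_pos
  have hDC : ((√D : ℝ) : ℂ) * (√D : ℝ) = (Fintype.card X : ℂ) := by
    rw [← Complex.ofReal_mul, Real.mul_self_sqrt hD0.le, hD]; simp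
  have hs0 : ((√D : ℝ) : ℂ) ≠ 0 := by
    simpa using (Real.sqrt_pos.2 hD0).ne'
  let k : EuclideanSpace ℂ (X × X) := WithLp.toLp 2 fun p => K p.1 p.2
  let v : T → EuclideanSpace ℂ (X × X) := fun τ =>
    WithLp.toLp 2 fun p => ((√D : ℝ) : ℂ)⁻¹ * star (x τ p.2 p.1)
  have hinner : ∀ τ, inner ℂ (v τ) k = ((√D : ℝ) : ℂ)⁻¹ * (x τ * K).trace := by
    intro τ
    simp only [PiLp.inner_apply, v, k, Matrix.trace, Matrix.diag, Matrix.mul_apply,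
      Fintype.sum_prod_type, Finset.mul_sum]
    rw [Finset.sum_comm]
    refine Finset.sum_congr rfl fun i _ => Finset.sum_congr rfl fun j _ => ?_
    simp
    ring
  have hvv : ∀ τ τ', inner ℂ (v τ) (v τ') =
      ((√D : ℝ) : ℂ)⁻¹ * ((√D : ℝ) : ℂ)⁻¹ * (x τ * (x τ')ᴴ).trace := by
    intro τ τ'
    simp only [PiLp.inner_apply, v, Matrix.trace, Matrix.diag, Matrix.mul_apply,
      Fintype.sum_prod_type, Finset.mul_sum, Matrix.conjTranspose_apply]
    rw [Finset.sum_comm]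
    refine Finset.sum_congr rfl fun i _ => Finset.sum_congr rfl fun j _ => ?_
    simp
    ring
  have hv : Orthonormal ℂ v := by
    rw [orthonormal_iff_ite]
    intro τ τ'
    rw [hvv]
    split_ifs with h
    · subst h
      rw [hx, Matrix.trace_one, ← hDC]
      field_simp
    · rw [horth _ _ h, mul_zero]
  have hk : ‖k‖ ^ 2 = D := by
    have h1 : (Kᴴ * K).trace = ((‖k‖ ^ 2 : ℝ) : ℂ) := by
      rw [EuclideanSpace.norm_sq_eq]
      simp only [k, Matrix.trace, Matrix.diag, Matrix.mul_apply, Fintype.sum_prod_type,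
        Matrix.conjTranspose_apply, Complex.ofReal_sum]
      rw [Finset.sum_comm]
      refine Finset.sum_congr rfl fun i _ => Finset.sum_congr rfl fun j _ => ?_
      rw [Complex.star_def, Complex.conj_mul', Complex.ofReal_pow]
    rw [hK, Matrix.trace_one] at h1
    exact_mod_cast h1.symm
  have hB := hv.sum_inner_products_le k (s := Finset.univ)
  rw [hk] at hB
  have hterm : ∀ τ, ‖(x τ * K).trace‖ ^ 2 = D * ‖inner ℂ (v τ) k‖ ^ 2 := by
    intro τ
    rw [hinner, norm_mul, norm_inv, Complex.norm_real, Real.norm_of_nonneg (Real.sqrt_nonneg _),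
      mul_pow, inv_pow, Real.sq_sqrt hD0.le]
    field_simp
  rw [Finset.sum_congr rfl fun τ _ => hterm τ, ← Finset.mul_sum, sq]
  exact mul_le_mul_of_nonneg_left hB hD0.le

end Doubling

/-- Expansion of an ordered product of sums. -/
theorem list_prod_sum {R O : Type*} [Semiring R] [Fintype O] :
    ∀ (t : ℕ) (f : Fin t → O → R),
      (List.ofFn fun b => ∑ o, f b o).prod = ∑ τ : Fin t → O, (List.ofFn fun b => f b (τ b)).prod
  | 0, f => by simp
  | t + 1, f => by
    rw [List.ofFn_succ, List.prod_cons, list_prod_sum t (fun b => f b.succ), Finset.sum_mul_sum,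
      ← (Fin.consEquiv fun _ => O).sum_comp, Fintype.sum_prod_type]
    refine Finset.sum_congr rfl fun o _ => Finset.sum_congr rfl fun τ _ => ?_
    simp [Fin.consEquiv]

/-! ### Majorana operators in blocks of four -/

/-- Reversal of a product of four anticommuting elements is an even permutation. -/
theorem mul_reverse_of_anticomm {R : Type*} [Ring R] {a b c d : R}
    (hba : b * a = -(a * b)) (hca : c * a = -(a * c)) (hda : d * a = -(a * d))
    (hcb : c * b = -(b * c)) (hdb : d * b = -(b * d)) (hdc : d * c = -(c * d)) :
    d * (c * (b * a)) = a * b * c * d := by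
  have hca' : ∀ x, c * (a * x) = -(a * (c * x)) := fun x => by
    rw [← mul_assoc, hca, neg_mul, mul_assoc]
  have hda' : ∀ x, d * (a * x) = -(a * (d * x)) := fun x => by
    rw [← mul_assoc, hda, neg_mul, mul_assoc]
  have hdb' : ∀ x, d * (b * x) = -(b * (d * x)) := fun x => by
    rw [← mul_assoc, hdb, neg_mul, mul_assoc]
  simp only [mul_assoc, mul_neg, neg_neg, hba, hcb, hdc, hca', hda', hdb']

section Clifford

open scoped Kronecker Matrix

variable {X : Type*} [Fintype X] [DecidableEq X] {t : ℕ}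

/-- Self-adjoint Majorana operators `c (b, 0), …, c (b, 3)` for each of `t` blocks, together with
the local parity `P b` of each block. -/
structure IsMajoranaBlocks (c : Fin t × Fin 4 → Matrix X X ℂ) (P : Fin t → Matrix X X ℂ) :
    Prop where
  mul_self : ∀ i, c i * c i = 1
  anticomm : ∀ i j, i ≠ j → c i * c j = -(c j * c i)
  herm : ∀ i, (c i)ᴴ = c i
  parity_eq : ∀ b, P b = -(c (b, 0) * c (b, 1) * c (b, 2) * c (b, 3))

/-- The pairing `∑ i, c i ⊗ conj (c i)` on two copies of the system, which commutes with
`U ⊗ conj U` if conjugation by `U` acts orthogonally on the Majorana operators. -/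
def majoranaPairing (ι : Type*) [Fintype ι] (c : ι → Matrix X X ℂ) : Matrix (X × X) (X × X) ℂ :=
  ∑ i, dbl (c i) (c i)

variable {c : Fin t × Fin 4 → Matrix X X ℂ} {P : Fin t → Matrix X X ℂ}

/-- Majorana operators have definite commutation signs with each other. -/
theorem IsMajoranaBlocks.mul_comm_sign (h : IsMajoranaBlocks c P) (i j : Fin t × Fin 4) :
    c i * c j = (-1 : ℂ) ^ (1 + if i = j then 1 else 0) • (c j * c i) := by
  by_cases hij : i = j
  · subst hij; simp
  · simp [hij, h.anticomm i j hij]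

omit [DecidableEq X] in
theorem sign_mul {a u v : Matrix X X ℂ} {k l : ℕ} (hu : a * u = (-1 : ℂ) ^ k • (u * a))
    (hv : a * v = (-1 : ℂ) ^ l • (v * a)) :
    a * (u * v) = (-1 : ℂ) ^ (k + l) • (u * v * a) := by
  rw [← mul_assoc, hu, smul_mul_assoc, mul_assoc, hv, mul_smul_comm, smul_smul, ← pow_add,
    mul_assoc]

omit [DecidableEq X] in
theorem sign_conjTranspose {a u : Matrix X X ℂ} {k : ℕ} (ha : aᴴ = a)
    (hu : a * u = (-1 : ℂ) ^ k • (u * a)) : a * uᴴ = (-1 : ℂ) ^ k • (uᴴ * a) := by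
  have h1 := congrArg Matrix.conjTranspose hu
  rw [Matrix.conjTranspose_smul, Matrix.conjTranspose_mul, Matrix.conjTranspose_mul, ha] at h1
  rw [h1, smul_smul, star_pow, star_neg, star_one, ← mul_pow]
  simp

/-- The parity of a block anticommutes with the Majorana operators of that block and commutes with
all others. -/
theorem IsMajoranaBlocks.mul_parity (h : IsMajoranaBlocks c P) (i : Fin t × Fin 4) (b : Fin t) :
    c i * P b = (-1 : ℂ) ^ (if i.1 = b then 1 else 0) • (P b * c i) := by
  have h4 := sign_mul (sign_mul (sign_mul (h.mul_comm_sign i (b, 0)) (h.mul_comm_sign i (b, 1)))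
    (h.mul_comm_sign i (b, 2))) (h.mul_comm_sign i (b, 3))
  rw [h.parity_eq, mul_neg, h4, neg_mul, smul_neg]
  congr 2
  obtain ⟨b', i⟩ := i
  by_cases hb : b' = b
  · fin_cases i <;> simp [hb] <;> norm_num
  · simp [hb]; norm_num

theorem IsMajoranaBlocks.reverse (h : IsMajoranaBlocks c P) (b : Fin t) :
    c (b, 3) * (c (b, 2) * (c (b, 1) * c (b, 0))) = -P b := by
  rw [h.parity_eq, neg_neg]
  apply mul_reverse_of_anticomm <;> exact h.anticomm _ _ (by simp)

theorem IsMajoranaBlocks.parity_conjTranspose (h : IsMajoranaBlocks c P) (b : Fin t) :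
    (P b)ᴴ = P b := by
  conv_lhs => rw [h.parity_eq]
  simp only [Matrix.conjTranspose_neg, Matrix.conjTranspose_mul, h.herm]
  rw [h.reverse, neg_neg]

theorem IsMajoranaBlocks.parity_mul_self (h : IsMajoranaBlocks c P) (b : Fin t) :
    P b * P b = 1 := by
  have hc : ∀ i x, c i * (c i * x) = x := fun i x => by rw [← mul_assoc, h.mul_self, one_mul]
  have e : P b = -(c (b, 3) * (c (b, 2) * (c (b, 1) * c (b, 0)))) := by rw [h.reverse, neg_neg]
  conv_lhs =>
    congr
    · rw [h.parity_eq b]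
    · rw [e]
  simp only [neg_mul_neg, mul_assoc, hc, h.mul_self]

/-! ### Monomials that survive the conjugation -/

/-- The one-block monomials `P ^ e * c o` that occur after the conjugation, where `c none = 1`:
these are `1`, the parity, and the products of one or of three Majorana operators. -/
def blockMonomial (c : Fin t × Fin 4 → Matrix X X ℂ) (P : Fin t → Matrix X X ℂ) (b : Fin t)
    (o : Option (Fin 4) × Fin 2) : Matrix X X ℂ :=
  P b ^ (o.2 : ℕ) * o.1.elim 1 fun i => c (b, i)

/-- The monomial that is paired with a given one on the second copy. -/
def partner (o : Option (Fin 4) × Fin 2) : Option (Fin 4) × Fin 2 :=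
  if o.1 = none then o else (o.1, o.2 + 1)

theorem partner_partner (o : Option (Fin 4) × Fin 2) : partner (partner o) = o := by
  revert o; decide

/-- Parity of the commutation sign of a one-block monomial with the Majorana operators of its
block, up to the parity of the monomial itself. -/
def blockPattern (o : Option (Fin 4) × Fin 2) (i : Fin 4) : ℕ :=
  (o.2 : ℕ) + if o.1 = some i then 1 else 0

set_option maxRecDepth 4000 in
theorem blockPattern_separates (o o' : Option (Fin 4) × Fin 2) (q : Fin 2)
    (h : ∀ i, ((q : ℕ) + (blockPattern o i + blockPattern o' i)) % 2 = 0) :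
    o.1.isSome = o'.1.isSome ∧ (q = 0 → o = o') := by
  revert o o' q
  decide

theorem IsMajoranaBlocks.blockMonomial_sign (h : IsMajoranaBlocks c P) (i : Fin t × Fin 4)
    (b : Fin t) (o : Option (Fin 4) × Fin 2) :
    c i * blockMonomial c P b o = (-1 : ℂ) ^ ((if o.1.isSome then 1 else 0) +
      if i.1 = b then blockPattern o i.2 else 0) • (blockMonomial c P b o * c i) := by
  obtain ⟨o, e⟩ := o
  have h1 : c i * P b ^ (e : ℕ) =
      (-1 : ℂ) ^ ((if i.1 = b then 1 else 0) * (e : ℕ)) • (P b ^ (e : ℕ) * c i) := by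
    fin_cases e
    · simp
    · simpa using h.mul_parity i b
  have h2 : c i * (o.elim 1 fun i => c (b, i)) = (-1 : ℂ) ^ ((if o.isSome then 1 else 0) +
      if i.1 = b ∧ o = some i.2 then 1 else 0) • ((o.elim 1 fun i => c (b, i)) * c i) := by
    cases o with
    | none => simp
    | some j =>
      have h3 := h.mul_comm_sign i (b, j)
      simp only [Option.elim, Option.isSome_some, if_true]
      rw [h3]
      congr 3
      simp [Prod.ext_iff, eq_comm]
  rw [blockMonomial, sign_mul h1 h2]
  congr 2
  simp only [blockPattern]
  by_cases hb : i.1 = b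
  · simp [hb]; ring
  · simp [hb]

theorem IsMajoranaBlocks.blockMonomial_unitary (h : IsMajoranaBlocks c P)
    (b : Fin t) (o : Option (Fin 4) × Fin 2) :
    blockMonomial c P b o * (blockMonomial c P b o)ᴴ = 1 := by
  obtain ⟨o, e⟩ := o
  have h1 : P b ^ (e : ℕ) * (P b ^ (e : ℕ))ᴴ = 1 := by
    rw [Matrix.conjTranspose_pow, h.parity_conjTranspose, ← (Commute.refl (P b)).mul_pow,
      h.parity_mul_self, one_pow]
  have h2 : (o.elim 1 fun i => c (b, i)) * (o.elim 1 fun i => c (b, i))ᴴ = 1 := by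
    cases o with
    | none => simp
    | some j => simp [h.herm, h.mul_self]
  rw [blockMonomial, Matrix.conjTranspose_mul]
  calc _ = P b ^ (e : ℕ) * ((o.elim 1 fun i => c (b, i)) * (o.elim 1 fun i => c (b, i))ᴴ) *
        (P b ^ (e : ℕ))ᴴ := by simp only [mul_assoc]
    _ = 1 := by rw [h2, mul_one, h1]

/-- Ordered product over the blocks of one-block monomials. -/
def monomial (c : Fin t × Fin 4 → Matrix X X ℂ) (P : Fin t → Matrix X X ℂ)
    (τ : Fin t → Option (Fin 4) × Fin 2) : Matrix X X ℂ :=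
  (List.ofFn fun b => blockMonomial c P b (τ b)).prod

theorem sign_list_prod {ι : Type*} {a : Matrix X X ℂ} {u : ι → Matrix X X ℂ} {k : ι → ℕ}
    (hu : ∀ b, a * u b = (-1 : ℂ) ^ k b • (u b * a)) (l : List ι) :
    a * (l.map u).prod = (-1 : ℂ) ^ (l.map k).sum • ((l.map u).prod * a) := by
  induction l with
  | nil => simp
  | cons b l ih => simpa using sign_mul (hu b) ih

theorem unitary_list_prod {ι : Type*} {u : ι → Matrix X X ℂ} (hu : ∀ b, u b * (u b)ᴴ = 1)
    (l : List ι) : (l.map u).prod * ((l.map u).prod)ᴴ = 1 := by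
  induction l with
  | nil => simp
  | cons b l ih =>
    rw [List.map_cons, List.prod_cons, Matrix.conjTranspose_mul, mul_assoc,
      ← mul_assoc (l.map u).prod, ih, one_mul, hu]

theorem IsMajoranaBlocks.monomial_sign (h : IsMajoranaBlocks c P) (i : Fin t × Fin 4)
    (τ : Fin t → Option (Fin 4) × Fin 2) :
    c i * monomial c P τ = (-1 : ℂ) ^ ((∑ b, if (τ b).1.isSome then 1 else 0) +
      blockPattern (τ i.1) i.2) • (monomial c P τ * c i) := by
  have h1 := sign_list_prod (fun b => h.blockMonomial_sign i b (τ b)) (List.finRange t)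
  rw [← List.ofFn_eq_map, ← List.ofFn_eq_map, List.sum_ofFn, Finset.sum_add_distrib,
    Finset.sum_ite_eq Finset.univ i.1] at h1
  simpa [monomial] using h1

theorem IsMajoranaBlocks.monomial_unitary (h : IsMajoranaBlocks c P)
    (τ : Fin t → Option (Fin 4) × Fin 2) : monomial c P τ * (monomial c P τ)ᴴ = 1 := by
  have h1 := unitary_list_prod (fun b => h.blockMonomial_unitary b (τ b)) (List.finRange t)
  rwa [← List.ofFn_eq_map] at h1

theorem trace_eq_zero_of_sign {a u : Matrix X X ℂ} (ha : a * a = 1) {k : ℕ} (hk : k % 2 = 1)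
    (hu : a * u = (-1 : ℂ) ^ k • (u * a)) : u.trace = 0 := by
  have h1 : u.trace = (a * u * a).trace := by
    rw [Matrix.trace_mul_comm, ← mul_assoc, ha, one_mul]
  rw [hu, Odd.neg_one_pow (Nat.odd_iff.2 hk), smul_mul_assoc, mul_assoc, ha, mul_one,
    Matrix.trace_smul, smul_eq_mul] at h1
  linear_combination h1 / 2

/-- Distinct monomials are trace-orthogonal, since some Majorana operator distinguishes their
commutation signs. -/
theorem IsMajoranaBlocks.monomial_orthogonal (h : IsMajoranaBlocks c P)
    (τ τ' : Fin t → Option (Fin 4) × Fin 2) (hne : τ ≠ τ') :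
    (monomial c P τ * (monomial c P τ')ᴴ).trace = 0 := by
  by_contra h0
  set m := ∑ b, if (τ b).1.isSome then 1 else 0 with hm
  set m' := ∑ b, if (τ' b).1.isSome then 1 else 0 with hm'
  let q : Fin 2 := ⟨(m + m') % 2, Nat.mod_lt _ two_pos⟩
  have h1 : ∀ b i, ((q : ℕ) +
      (blockPattern (τ b) i + blockPattern (τ' b) i)) % 2 = 0 := by
    intro b i
    by_contra h2
    refine h0 (trace_eq_zero_of_sign (h.mul_self (b, i)) ?_
      (sign_mul (h.monomial_sign (b, i) τ)
        (sign_conjTranspose (h.herm _) (h.monomial_sign (b, i) τ'))))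
    simp only [q] at h2
    simp only [← hm, ← hm']
    omega
  have h2 : m = m' := Finset.sum_congr rfl fun b _ => by
    rw [(blockPattern_separates _ _ _ (h1 b)).1]
  refine hne (funext fun b => (blockPattern_separates _ _ _ (h1 b)).2 ?_)
  ext
  simp only [q, h2, Fin.val_zero]
  omega

/-! ### Conjugation of the witness -/

/-- Coefficients of the conjugated witness. -/
noncomputable def coeff (s : ℝ) (o : Option (Fin 4) × Fin 2) : ℂ :=
  if o.1 = none then 1 else if o.2 = 0 then s / 2 else -(s / 2)

theorem norm_coeff_le {s : ℝ} (hs : s ^ 2 = 1) (o : Option (Fin 4) × Fin 2) :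
    ‖coeff s o‖ ≤ 1 := by
  have h1 : |s| = 1 := by rw [← sq_eq_sq₀ (abs_nonneg s) zero_le_one, sq_abs, hs, one_pow]
  unfold coeff
  split_ifs <;> norm_num [h1]

/-- The sum of `c i ⊗ conj (c i)` over the Majorana operators of one block. -/
def blockPairing (c : Fin t × Fin 4 → Matrix X X ℂ) (b : Fin t) : Matrix (X × X) (X × X) ℂ :=
  dbl (c (b, 0)) (c (b, 0)) + dbl (c (b, 1)) (c (b, 1)) + dbl (c (b, 2)) (c (b, 2)) +
    dbl (c (b, 3)) (c (b, 3))

omit [DecidableEq X] in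
theorem sign_dbl {a a' u u' : Matrix X X ℂ} {k l : ℕ} (hu : a * u = (-1 : ℂ) ^ k • (u * a))
    (hu' : a' * u' = (-1 : ℂ) ^ l • (u' * a')) :
    dbl a a' * dbl u u' = (-1 : ℂ) ^ (k + l) • (dbl u u' * dbl a a') := by
  rw [dbl_mul, dbl_mul, hu, hu']
  rcases Nat.even_or_odd k with hk | hk <;> rcases Nat.even_or_odd l with hl | hl <;>
    simp [pow_add, hk.neg_one_pow, hl.neg_one_pow, dbl_neg_left, dbl_neg_right]

omit [DecidableEq X] in
theorem commute_dbl_self {a u : Matrix X X ℂ} {k : ℕ} (hu : a * u = (-1 : ℂ) ^ k • (u * a)) :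
    Commute (dbl a a) (dbl u u) := by
  rw [commute_iff_eq, sign_dbl hu hu, Even.neg_one_pow ⟨k, rfl⟩, one_smul]

theorem IsMajoranaBlocks.commute_dbl (h : IsMajoranaBlocks c P) (i j : Fin t × Fin 4) :
    Commute (dbl (c i) (c i)) (dbl (c j) (c j)) :=
  commute_dbl_self (h.mul_comm_sign i j)

theorem IsMajoranaBlocks.dbl_parity (h : IsMajoranaBlocks c P) (b : Fin t) :
    dbl (P b) (P b) = dbl (c (b, 0)) (c (b, 0)) * dbl (c (b, 1)) (c (b, 1)) *
      dbl (c (b, 2)) (c (b, 2)) * dbl (c (b, 3)) (c (b, 3)) := by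
  simp only [h.parity_eq, dbl_neg_neg, dbl_mul]

theorem IsMajoranaBlocks.blockPairing_sq (h : IsMajoranaBlocks c P) (b : Fin t) :
    blockPairing c b * blockPairing c b * (1 - dbl (P b) (P b)) =
      (4 : ℂ) • (1 - dbl (P b) (P b)) := by
  have hsq : ∀ i, dbl (c i) (c i) * dbl (c i) (c i) = 1 := fun i => by
    rw [dbl_mul, h.mul_self, dbl_one]
  rw [h.dbl_parity]
  exact sum_sq_mul_one_sub_prod (hsq _) (hsq _) (hsq _) (hsq _) (h.commute_dbl _ _)
    (h.commute_dbl _ _) (h.commute_dbl _ _) (h.commute_dbl _ _) (h.commute_dbl _ _)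
    (h.commute_dbl _ _)

theorem IsMajoranaBlocks.pairing_mul_parity (h : IsMajoranaBlocks c P) (b : Fin t) :
    majoranaPairing _ c * dbl 1 (P b) =
      dbl 1 (P b) * (majoranaPairing _ c - (2 : ℂ) • blockPairing c b) := by
  have h1 : ∀ i, dbl (c i) (c i) * dbl 1 (P b) =
      dbl 1 (P b) * dbl (c i) (c i) - if i.1 = b then (2 : ℂ) • (dbl 1 (P b) * dbl (c i) (c i))
        else 0 := by
    intro i
    have h2 := sign_dbl (a := c i) (u := 1) (k := 0) (by simp) (h.mul_parity i b)
    rw [h2]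
    split_ifs
    · simp; module
    · simp
  have h3 : blockPairing c b = ∑ j, dbl (c (b, j)) (c (b, j)) := by
    rw [Fin.sum_univ_four, blockPairing]
  have h4 : (∑ i : Fin t × Fin 4, if i.1 = b then (2 : ℂ) • (dbl 1 (P b) * dbl (c i) (c i)) else 0)
      = dbl 1 (P b) * ((2 : ℂ) • blockPairing c b) := by
    rw [h3, Fintype.sum_prod_type, Finset.sum_eq_single b]
    · simp [Finset.mul_sum, Finset.smul_sum]
    · intro b' _ hb
      simp [hb]
    · simp
  rw [majoranaPairing, Finset.sum_mul, Finset.sum_congr rfl fun i _ => h1 i,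
    Finset.sum_sub_distrib, mul_sub, Finset.mul_sum, h4]

theorem IsMajoranaBlocks.commute_pairing_blockPairing (h : IsMajoranaBlocks c P) (b : Fin t) :
    Commute (majoranaPairing _ c) (blockPairing c b) := by
  refine Commute.sum_left _ _ _ fun i _ => ?_
  exact (((h.commute_dbl _ _).add_right (h.commute_dbl _ _)).add_right
    (h.commute_dbl _ _)).add_right (h.commute_dbl _ _)

theorem IsMajoranaBlocks.commute_pairing_parity (h : IsMajoranaBlocks c P) (b : Fin t) :
    Commute (majoranaPairing _ c) (dbl (P b) (P b)) :=
  Commute.sum_left _ _ _ fun i _ => commute_dbl_self (h.mul_parity i b)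

/-- The factor `(1 - i s P) ⊗ conj (1 - i s P)` of the doubled witness. -/
theorem IsMajoranaBlocks.dbl_witness (h : IsMajoranaBlocks c P) {s : ℝ} (hs : s ^ 2 = 1)
    (b : Fin t) : dbl (1 - (Complex.I * s) • P b) (1 - (Complex.I * s) • P b) =
      1 + dbl (P b) (P b) + (Complex.I * s) • (dbl 1 (P b) * (1 - dbl (P b) (P b))) := by
  have hs' : (s : ℂ) ^ 2 = 1 := by exact_mod_cast hs
  rw [mul_sub, mul_one, dbl_mul, one_mul, h.parity_mul_self, ← dbl_one]
  ext p q
  simp only [dbl_apply, Matrix.sub_apply, Matrix.add_apply, Matrix.smul_apply, smul_eq_mul,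
    Complex.star_def, map_sub, map_mul, Complex.conj_I, Complex.conj_ofReal]
  linear_combination (-Complex.I ^ 2 * P b p.1 q.1 * (starRingEnd ℂ) (P b p.2 q.2)) * hs' -
    (P b p.1 q.1 * (starRingEnd ℂ) (P b p.2 q.2)) * Complex.I_sq

/-- After the conjugation the factors of the doubled witness are combinations of monomials. -/
theorem IsMajoranaBlocks.conj_witness_eq_sum (h : IsMajoranaBlocks c P) (s : ℝ) (b : Fin t) :
    1 + dbl (P b) (P b) + ((s : ℂ) / 2) •
        (dbl 1 (P b) * blockPairing c b * (1 - dbl (P b) (P b))) =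
      ∑ o, coeff s o • dbl (blockMonomial c P b o) (blockMonomial c P b (partner o)) := by
  have h1 : ∀ i, P b * c (b, i) * P b = -c (b, i) := by
    intro i
    have h2 := h.mul_parity (b, i) b
    simp only [if_true, pow_one, neg_smul, one_smul] at h2
    rw [mul_assoc, h2, mul_neg, ← mul_assoc, h.parity_mul_self, one_mul]
  have h3 : ∀ i, c (b, i) * P b = -(P b * c (b, i)) := by
    intro i
    simpa using h.mul_parity (b, i) b
  rw [blockPairing, Fintype.sum_prod_type, Fintype.sum_option, Fin.sum_univ_four]
  simp only [Fin.sum_univ_two, coeff, partner, blockMonomial, mul_add, add_mul, mul_sub, dbl_mul,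
    one_mul, mul_one, h1, h3, dbl_neg_neg]
  simp [dbl_one]
  module

/-- **The key estimate.** The operator `∏ b, (1 - i s P b)` has overlap at most `card X` with every
unitary `K` for which `K ⊗ conj K` commutes with the Majorana pairing. -/
theorem IsMajoranaBlocks.norm_trace_witness_mul_le (h : IsMajoranaBlocks c P) {s : ℝ}
    (hs : s ^ 2 = 1) {K : Matrix X X ℂ} (hK : Kᴴ * K = 1)
    (hΛ : Commute (majoranaPairing _ c) (dbl K K)) :
    ‖((List.ofFn fun b => 1 - (Complex.I * s) • P b).prod * K).trace‖ ≤ Fintype.card X := by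
  -- The square of the trace is a trace on two copies, and there the witness may be conjugated.
  obtain ⟨V, V', hV, hVK, hVM⟩ : ∃ V V' : Matrix (X × X) (X × X) ℂ, V' * V = 1 ∧
      Commute V (dbl K K) ∧ ∀ b,
        V * dbl (1 - (Complex.I * s) • P b) (1 - (Complex.I * s) • P b) =
        (∑ o, coeff s o • dbl (blockMonomial c P b o) (blockMonomial c P b (partner o))) * V := by
    obtain ⟨V, V', h1, h2, h3⟩ := @exists_conj_blocks _ (Fin t) Matrix.linftyOpNormedRing
      Matrix.linftyOpNormedAlgebra (by
        let : NormedRing (Matrix (X × X) (X × X) ℂ) := Matrix.linftyOpNormedRing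
        let : NormedAlgebra ℂ (Matrix (X × X) (X × X) ℂ) := Matrix.linftyOpNormedAlgebra
        exact FiniteDimensional.complete ℂ _) _ _ _ _ h.pairing_mul_parity
      h.commute_pairing_blockPairing h.commute_pairing_parity h.blockPairing_sq s
    refine ⟨V, V', h1, h2 _ hΛ, fun b => ?_⟩
    rw [h.dbl_witness hs, ← h.conj_witness_eq_sum]
    exact h3 b
  have hlist : ∀ l : List (Fin t),
      V * (l.map fun b => dbl (1 - (Complex.I * s) • P b) (1 - (Complex.I * s) • P b)).prod =
      (l.map fun b => ∑ o, coeff s o •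
        dbl (blockMonomial c P b o) (blockMonomial c P b (partner o))).prod * V := by
    intro l
    induction l with
    | nil => simp
    | cons b l ih =>
      simp only [List.map_cons, List.prod_cons]
      rw [← mul_assoc, hVM, mul_assoc, ih, mul_assoc]
  have hM := hlist (List.finRange t)
  rw [list_prod_dbl, ← List.ofFn_eq_map, ← List.ofFn_eq_map, list_prod_sum] at hM
  set W := (List.ofFn fun b => 1 - (Complex.I * s) • P b).prod with hW
  have hsum : ∀ τ : Fin t → Option (Fin 4) × Fin 2,
      (List.ofFn fun b => coeff s (τ b) •
        dbl (blockMonomial c P b (τ b)) (blockMonomial c P b (partner (τ b)))).prod =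
      (∏ b, coeff s (τ b)) • dbl (monomial c P τ) (monomial c P (partner ∘ τ)) := by
    intro τ
    have h1 : ∀ l : List (Fin t), (l.map fun b => coeff s (τ b) •
        dbl (blockMonomial c P b (τ b)) (blockMonomial c P b (partner (τ b)))).prod =
        (l.map fun b => coeff s (τ b)).prod • (l.map fun b =>
          dbl (blockMonomial c P b (τ b)) (blockMonomial c P b (partner (τ b)))).prod := by
      intro l
      induction l with
      | nil => simp
      | cons b l ih => simp [ih, smul_smul, mul_comm]
    have h2 := h1 (List.finRange t)
    rw [list_prod_dbl] at h2
    simpa only [← List.ofFn_eq_map, List.prod_ofFn] using! h2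
  simp only [hsum] at hM
  have htr : (W * K).trace * star (W * K).trace = ∑ τ : Fin t → Option (Fin 4) × Fin 2,
      (∏ b, coeff s (τ b)) * ((monomial c P τ * K).trace *
        star (monomial c P (partner ∘ τ) * K).trace) := by
    have h1 : (dbl W W * dbl K K).trace = ((∑ τ : Fin t → Option (Fin 4) × Fin 2,
        (∏ b, coeff s (τ b)) • dbl (monomial c P τ) (monomial c P (partner ∘ τ))) *
          dbl K K).trace := by
      have hV2 := mul_eq_one_comm.1 hV
      calc _ = (V' * (V * dbl W W * dbl K K)).trace := by
            rw [← mul_assoc, ← mul_assoc, hV, one_mul]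
        _ = _ := by
            rw [hM, Matrix.trace_mul_comm, mul_assoc _ V, hVK.eq, mul_assoc, mul_assoc, hV2,
              mul_one]
    rw [dbl_mul, trace_dbl] at h1
    rw [h1, Matrix.sum_mul, Matrix.trace_sum]
    simp only [smul_mul_assoc, Matrix.trace_smul, dbl_mul, trace_dbl, smul_eq_mul]
  have hB := sum_norm_trace_sq_le (monomial c P) K h.monomial_unitary hK h.monomial_orthogonal
  have hinv : Function.Involutive
      (fun τ : Fin t → Option (Fin 4) × Fin 2 => partner ∘ τ) := fun τ => by
    funext b; simp [partner_partner]
  have hB' : ∑ τ, ‖(monomial c P (partner ∘ τ) * K).trace‖ ^ 2 ≤ (Fintype.card X : ℝ) ^ 2 := by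
    exact (Equiv.sum_comp hinv.toPerm fun τ => ‖(monomial c P τ * K).trace‖ ^ 2).trans_le hB
  rw [← sq_le_sq₀ (norm_nonneg _) (Nat.cast_nonneg _)]
  calc ‖(W * K).trace‖ ^ 2 = ‖(W * K).trace * star (W * K).trace‖ := by
        rw [norm_mul, norm_star, sq]
    _ ≤ ∑ τ : Fin t → Option (Fin 4) × Fin 2, (‖(monomial c P τ * K).trace‖ ^ 2 +
          ‖(monomial c P (partner ∘ τ) * K).trace‖ ^ 2) / 2 := by
        rw [htr]
        refine (norm_sum_le _ _).trans (Finset.sum_le_sum fun τ _ => ?_)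
        rw [norm_mul, norm_mul, norm_star, norm_prod]
        have h1 : ∏ b, ‖coeff s (τ b)‖ ≤ 1 :=
          Finset.prod_le_one (fun _ _ => norm_nonneg _) fun b _ => norm_coeff_le hs _
        have h2 := two_mul_le_add_sq ‖(monomial c P τ * K).trace‖
          ‖(monomial c P (partner ∘ τ) * K).trace‖
        have h3 := mul_le_of_le_one_left (mul_nonneg (norm_nonneg (monomial c P τ * K).trace)
          (norm_nonneg (monomial c P (partner ∘ τ) * K).trace)) h1
        linarith
    _ ≤ (Fintype.card X : ℝ) ^ 2 := by
        rw [← Finset.sum_div, Finset.sum_add_distrib]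
        linarith

end Clifford

/-! ### Gates on a subset of the qubits -/

theorem onQubits_mul {m n : ℕ} {f : Fin m → Fin n} (hf : Function.Injective f) (A B : QOp m) :
    onQubits f (A * B) = onQubits f A * onQubits f B := by
  ext x z
  rw [Matrix.mul_apply]
  have hinj : Function.Injective fun w : Bits m => Function.extend f w x := fun w w' h => by
    funext k
    have := congrFun h (f k)
    simpa only [hf.extend_apply] using this
  -- Only the labels that agree with `x` off the range of `f` contribute.
  rw [← Fintype.sum_of_injective _ hinj
    (fun w => A (fun k => x (f k)) w * if ∀ i, (∀ k, f k ≠ i) → x i = z i then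
      B w (fun k => z (f k)) else 0)]
  · simp only [onQubits, Matrix.mul_apply]
    split_ifs <;> simp
  · intro y hy
    have : ¬ ∀ i, (∀ k, f k ≠ i) → x i = y i := by
      intro h
      refine hy ⟨fun k => y (f k), funext fun i => ?_⟩
      by_cases hi : ∃ k, f k = i
      · obtain ⟨k, rfl⟩ := hi
        exact hf.extend_apply _ _ _
      · refine (Function.extend_apply' _ _ _ hi).trans ?_
        exact h i (not_exists.1 hi)
    rw [onQubits, if_neg this, zero_mul]
  · intro w
    have h1 : ∀ i, (∀ k, f k ≠ i) → Function.extend f w x i = x i := fun i hi =>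
      Function.extend_apply' _ _ _ (not_exists.2 hi)
    simp only [onQubits, hf.extend_apply]
    rw [if_pos fun i hi => (h1 i hi).symm]
    congr 1
    refine if_congr ⟨fun h i hi => ?_, fun h i hi => ?_⟩ rfl rfl
    · rw [h1 i hi, h i hi]
    · rw [← h i hi, h1 i hi]

theorem onQubits_one {m n : ℕ} (f : Fin m → Fin n) : onQubits f (1 : QOp m) = 1 := by
  ext x y
  simp only [onQubits, Matrix.one_apply]
  by_cases h : x = y
  · subst h; simp
  · rw [if_neg h, ite_eq_right_iff]
    intro h1
    rw [if_neg]
    intro h2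
    refine h (funext fun i => ?_)
    by_cases hi : ∃ k, f k = i
    · obtain ⟨k, rfl⟩ := hi
      exact congrFun h2 k
    · exact h1 i (not_exists.1 hi)

theorem onQubits_comp {l m n : ℕ} {g : Fin m → Fin n} (hg : Function.Injective g)
    (f : Fin l → Fin m) (A : QOp l) : onQubits g (onQubits f A) = onQubits (g ∘ f) A := by
  ext x y
  simp only [onQubits, Function.comp]
  rw [← ite_and]
  refine if_congr ⟨fun ⟨h1, h2⟩ i hi => ?_, fun h => ⟨fun i hi => ?_, fun k hk => ?_⟩⟩ rfl rfl
  · by_cases hi' : ∃ k, g k = i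
    · obtain ⟨k, rfl⟩ := hi'
      exact h2 k fun j hj => hi j (by rw [hj])
    · exact h1 i (not_exists.1 hi')
  · exact h i fun k => hi (f k)
  · exact h (g k) fun j hj => hk j (hg hj)

/-- `onQubits f` as a monoid homomorphism. -/
def onQubitsHom {m n : ℕ} (f : Fin m → Fin n) (hf : Function.Injective f) : QOp m →* QOp n where
  toFun := onQubits f
  map_one' := onQubits_one f
  map_mul' := onQubits_mul hf

/-- A Gaussian unitary on a block of consecutive qubits is Gaussian on the whole system. -/
theorem onQubits_mem_gaussianUnitaries {m n : ℕ} {f : Fin m → Fin n} {d : ℕ}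
    (hf : ∀ i, (f i : ℕ) = (i : ℕ) + d) {U : QOp m} (hU : U ∈ gaussianUnitaries m) :
    onQubits f U ∈ gaussianUnitaries n := by
  have hinj : Function.Injective f := fun i j h => by
    have h1 := hf i
    rw [h, hf j] at h1
    exact Fin.ext (by omega)
  suffices h : gaussianUnitaries m ≤ (gaussianUnitaries n).comap (onQubitsHom f hinj) from h hU
  refine Submonoid.closure_le.2 ?_
  rintro U (⟨j, k, A, B, hjk, hA, hB, hdet, rfl⟩ | ⟨j, rfl | rfl⟩)
  · refine Submonoid.subset_closure (Or.inl ⟨f j, f k, A, B, ?_, hA, hB, hdet, ?_⟩)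
    · rw [hf, hf]; omega
    · refine (onQubits_comp hinj _ _).trans (congrArg (onQubits · _) ?_)
      ext i; fin_cases i <;> rfl
  · refine Submonoid.subset_closure (Or.inr ⟨f j, Or.inl ?_⟩)
    refine (onQubits_comp hinj _ _).trans (congrArg (onQubits · _) ?_)
    ext i; fin_cases i; rfl
  · refine Submonoid.subset_closure (Or.inr ⟨f j, Or.inr ?_⟩)
    refine (onQubits_comp hinj _ _).trans (congrArg (onQubits · _) ?_)
    ext i; fin_cases i; rfl

/-! ### Tensor products of operators on blocks -/

/-- Splitting of the label of `t * m` qubits into the labels of `t` blocks of `m` qubits. -/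
def blockEquiv (t m : ℕ) : Bits (t * m) ≃ (Fin t → Bits m) :=
  (Equiv.arrowCongr finProdFinEquiv.symm (Equiv.refl _)).trans (Equiv.curry _ _ _)

theorem blockEquiv_apply {t m : ℕ} (x : Bits (t * m)) (k : Fin t) (i : Fin m) :
    blockEquiv t m x k i = x (finProdFinEquiv (k, i)) := rfl

/-- The tensor product `K 0 ⊗ K 1 ⊗ ⋯` of operators on blocks of `m` consecutive qubits, as a
monoid homomorphism. -/
def tensorProd (t m : ℕ) : (Fin t → QOp m) →* QOp (t * m) where
  toFun K := Matrix.of fun x y => ∏ k, K k (blockEquiv t m x k) (blockEquiv t m y k)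
  map_one' := by
    ext x y
    by_cases h : x = y
    · subst h; simp
    · have : blockEquiv t m x ≠ blockEquiv t m y := fun h' => h ((blockEquiv t m).injective h')
      obtain ⟨k, hk⟩ := Function.ne_iff.1 this
      rw [Matrix.one_apply_ne h]
      exact Finset.prod_eq_zero (Finset.mem_univ k) (Matrix.one_apply_ne hk)
  map_mul' K L := by
    ext x z
    rw [Matrix.mul_apply, ← (blockEquiv t m).symm.sum_comp]
    simp only [Matrix.of_apply, Pi.mul_apply, Matrix.mul_apply, Equiv.apply_symm_apply,
      ← Finset.prod_mul_distrib]
    exact Finset.prod_univ_sum (fun _ => Finset.univ) _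

theorem tensorProd_apply {t m : ℕ} (K : Fin t → QOp m) (x y : Bits (t * m)) :
    tensorProd t m K x y = ∏ k, K k (blockEquiv t m x k) (blockEquiv t m y k) := rfl

theorem tensorPow_eq {m : ℕ} (U : QOp m) (t : ℕ) : tensorPow U t = tensorProd t m fun _ => U := rfl

theorem tensorProd_mulSingle {t m : ℕ} (k : Fin t) (A : QOp m) :
    tensorProd t m (Pi.mulSingle k A) = onQubits (fun i => finProdFinEquiv (k, i)) A := by
  ext x y
  rw [tensorProd_apply, ← Finset.mul_prod_erase _ _ (Finset.mem_univ k), Pi.mulSingle_eq_same]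
  have h1 : ∏ l ∈ Finset.univ.erase k, (Pi.mulSingle k A : Fin t → QOp m) l (blockEquiv t m x l)
      (blockEquiv t m y l) = if ∀ i, (∀ j : Fin m, finProdFinEquiv (k, j) ≠ i) → x i = y i then
        1 else 0 := by
    split_ifs with h
    · refine Finset.prod_eq_one fun l hl => ?_
      have hlk := Finset.ne_of_mem_erase hl
      rw [Pi.mulSingle_eq_of_ne hlk]
      have : blockEquiv t m x l = blockEquiv t m y l := funext fun i =>
        h _ fun j hj => hlk (Prod.ext_iff.1 (finProdFinEquiv.injective hj)).1.symm
      rw [this, Matrix.one_apply_eq]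
    · push Not at h
      obtain ⟨i, hi, hxy⟩ := h
      obtain ⟨⟨l, j⟩, rfl⟩ := finProdFinEquiv.surjective i
      have hlk : l ≠ k := fun e => hi j (by rw [e])
      refine Finset.prod_eq_zero (Finset.mem_erase.2 ⟨hlk, Finset.mem_univ l⟩) ?_
      rw [Pi.mulSingle_eq_of_ne hlk]
      exact Matrix.one_apply_ne fun e => hxy (congrFun e j)
  rw [h1, onQubits, mul_ite, mul_one, mul_zero]
  rfl

theorem tensorProd_mem_gaussianUnitaries {t m : ℕ} {K : Fin t → QOp m}
    (hK : ∀ k, K k ∈ gaussianUnitaries m) : tensorProd t m K ∈ gaussianUnitaries (t * m) := by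
  refine Submonoid.pi_mem_of_mulSingle_mem (H := (gaussianUnitaries (t * m)).comap
    (tensorProd t m)) K fun k => ?_
  rw [Submonoid.mem_comap, tensorProd_mulSingle]
  refine onQubits_mem_gaussianUnitaries (d := m * k) (fun i => ?_) (hK k)
  simp [finProdFinEquiv]

theorem tensorPow_mul {m : ℕ} (U W : QOp m) (t : ℕ) :
    tensorPow (U * W) t = tensorPow U t * tensorPow W t := by
  simp only [tensorPow_eq, ← map_mul]; rfl

theorem trace_tensorPow {m : ℕ} (U : QOp m) (t : ℕ) : (tensorPow U t).trace = U.trace ^ t := by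
  rw [Matrix.trace, ← (blockEquiv t m).symm.sum_comp]
  simp only [Matrix.diag, tensorPow_eq, tensorProd_apply, Equiv.apply_symm_apply]
  rw [← Fintype.piFinset_univ, ← Finset.prod_univ_sum (fun _ => Finset.univ) fun _ x => U x x]
  simp [Matrix.trace]

theorem tensorPow_sum {m : ℕ} {ι : Type*} [Fintype ι] (c : ι → ℂ)
    (K : ι → QOp m) (t : ℕ) : tensorPow (∑ j, c j • K j) t =
      ∑ τ : Fin t → ι, (∏ k, c (τ k)) • tensorProd t m fun k => K (τ k) := by
  classical
  ext x y
  simp only [tensorPow_eq, tensorProd_apply, Matrix.sum_apply, Matrix.smul_apply, smul_eq_mul,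
    ← Finset.prod_mul_distrib]
  rw [Finset.prod_univ_sum, Fintype.piFinset_univ]

/-! ### Bounds on the extents -/

theorem unitaryExtent_le {n χ : ℕ} {U : QOp n} (c : Fin χ → ℂ) (K : Fin χ → QOp n)
    (hK : ∀ j, K j ∈ gaussianUnitaries n) (hU : U = ∑ j, c j • K j) :
    unitaryExtent U ≤ (∑ j, ‖c j‖) ^ 2 := by
  refine csInf_le ⟨0, ?_⟩ ⟨χ, c, K, hK, hU, rfl⟩
  rintro r ⟨χ, c, K, -, -, rfl⟩
  positivity

/-- Expanding the tensor power of a Gaussian decomposition gives a Gaussian decomposition. -/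
theorem exists_decomposition_tensorPow {m χ : ℕ} {U : QOp m} (c : Fin χ → ℂ) (K : Fin χ → QOp m)
    (hK : ∀ j, K j ∈ gaussianUnitaries m) (hU : U = ∑ j, c j • K j) (t : ℕ) :
    ∃ (χ' : ℕ) (c' : Fin χ' → ℂ) (K' : Fin χ' → QOp (t * m)),
      (∀ j, K' j ∈ gaussianUnitaries (t * m)) ∧ tensorPow U t = ∑ j, c' j • K' j ∧
        ∑ j, ‖c' j‖ = (∑ j, ‖c j‖) ^ t := by
  let e := Fintype.equivFin (Fin t → Fin χ)
  refine ⟨_, fun j => ∏ k, c (e.symm j k), fun j => tensorProd t m fun k => K (e.symm j k),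
    fun j => tensorProd_mem_gaussianUnitaries fun k => hK _, ?_, ?_⟩
  · rw [hU, tensorPow_sum]
    exact (e.symm.sum_comp fun τ => (∏ k, c (τ k)) • tensorProd t m fun k => K (τ k)).symm
  · rw [e.symm.sum_comp fun τ => ‖∏ k, c (τ k)‖]
    simp only [norm_prod]
    rw [← Fintype.piFinset_univ, ← Finset.prod_univ_sum (fun _ => Finset.univ) fun _ j => ‖c j‖,
      Finset.prod_const, Finset.card_univ, Fintype.card_fin]

theorem unitaryExtent_tensorPow_le {m χ : ℕ} {U : QOp m} (c : Fin χ → ℂ) (K : Fin χ → QOp m)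
    (hK : ∀ j, K j ∈ gaussianUnitaries m) (hU : U = ∑ j, c j • K j) (t : ℕ) :
    unitaryExtent (tensorPow U t) ≤ (∑ j, ‖c j‖) ^ (2 * t) := by
  obtain ⟨χ', c', K', hK', hU', hc'⟩ := exists_decomposition_tensorPow c K hK hU t
  rw [mul_comm 2 t, pow_mul, ← hc']
  exact unitaryExtent_le c' K' hK' hU'

/-! ### Jordan–Wigner Majorana operators -/

/-- The sign `∏ l < j, (-1) ^ y l` of the Jordan–Wigner string to the left of qubit `j`. -/
def stringSign {n : ℕ} (j : Fin n) (y : Bits n) : ℂ :=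
  ∏ l ∈ Finset.univ.filter (· < j), (-1 : ℂ) ^ (y l : ℕ)

/-- The phase with which the Majorana operator `(j, s)` maps `|y⟩` to `|y + e_j⟩`. -/
noncomputable def majoranaPhase {n : ℕ} (i : Fin n × Fin 2) (y : Bits n) : ℂ :=
  stringSign i.1 y * if i.2 = 0 then 1 else Complex.I * (-1) ^ (y i.1 : ℕ)

/-- The operator `|y⟩ ↦ φ y |y + a⟩`. -/
def shiftOp {n : ℕ} (a : Bits n) (φ : Bits n → ℂ) : QOp n := fun x y =>
  if x = y + a then φ y else 0

/-- The Majorana operators `Z ⋯ Z X_j` (for `s = 0`) and `Z ⋯ Z Y_j` (for `s = 1`). -/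
noncomputable def majorana {n : ℕ} (i : Fin n × Fin 2) : QOp n :=
  shiftOp (Pi.single i.1 1) (majoranaPhase i)

theorem bits_add_self {n : ℕ} (a : Bits n) : a + a = 0 := by
  funext i
  have : ∀ u : Fin 2, u + u = 0 := by decide
  exact this (a i)

theorem bits_add_add_self {n : ℕ} (x a : Bits n) : x + a + a = x := by
  rw [add_assoc, bits_add_self, add_zero]

theorem bits_eq_add_iff {n : ℕ} (x y a : Bits n) : x = y + a ↔ y = x + a :=
  ⟨fun h => by rw [h, bits_add_add_self], fun h => by rw [h, bits_add_add_self]⟩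

theorem shiftOp_mul_apply {n : ℕ} (a : Bits n) (φ : Bits n → ℂ) (U : QOp n) (x y : Bits n) :
    (shiftOp a φ * U) x y = φ (x + a) * U (x + a) y := by
  rw [Matrix.mul_apply, Finset.sum_eq_single (x + a)]
  · simp [shiftOp, bits_add_add_self]
  · intro z _ hz
    rw [shiftOp, if_neg (fun h => hz ((bits_eq_add_iff _ _ _).1 h)), zero_mul]
  · simp

theorem mul_shiftOp_apply {n : ℕ} (a : Bits n) (φ : Bits n → ℂ) (U : QOp n) (x y : Bits n) :
    (U * shiftOp a φ) x y = U x (y + a) * φ y := by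
  rw [Matrix.mul_apply, Finset.sum_eq_single (y + a)]
  · simp [shiftOp]
  · intro z _ hz
    rw [shiftOp, if_neg hz, mul_zero]
  · simp

theorem shiftOp_mul {n : ℕ} (a b : Bits n) (φ ψ : Bits n → ℂ) :
    shiftOp a φ * shiftOp b ψ = shiftOp (b + a) fun y => φ (y + b) * ψ y := by
  ext x y
  rw [mul_shiftOp_apply]
  simp only [shiftOp, add_assoc]
  split_ifs <;> simp

theorem shiftOp_sign {n : ℕ} {a b : Bits n} {φ ψ : Bits n → ℂ} (k l : ℕ)
    (hφ : ∀ y, φ (y + b) = (-1) ^ k * φ y) (hψ : ∀ y, ψ (y + a) = (-1) ^ l * ψ y) :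
    shiftOp a φ * shiftOp b ψ = (-1 : ℂ) ^ (k + l) • (shiftOp b ψ * shiftOp a φ) := by
  rw [shiftOp_mul, shiftOp_mul, add_comm b a]
  ext x y
  simp only [shiftOp, Matrix.smul_apply, smul_eq_mul, hφ, hψ]
  have h1 : ((-1 : ℂ) ^ l) ^ 2 = 1 := by rw [← pow_mul, mul_comm, pow_mul]; simp
  split_ifs
  · rw [pow_add]
    linear_combination (-(-1 : ℂ) ^ k * φ y * ψ y) * h1
  · simp

theorem neg_one_pow_bit_add_one (u : Fin 2) :
    (-1 : ℂ) ^ ((u + 1 : Fin 2) : ℕ) = -(-1) ^ (u : ℕ) := by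
  fin_cases u <;> simp

theorem stringSign_flip {n : ℕ} (j k : Fin n) (y : Bits n) :
    stringSign j (y + Pi.single k 1) = (-1) ^ (if k < j then 1 else 0) * stringSign j y := by
  unfold stringSign
  by_cases h : k < j
  · have hk : k ∈ Finset.univ.filter (· < j) := by simpa using h
    rw [← Finset.mul_prod_erase _ _ hk, ← Finset.mul_prod_erase _ _ hk, if_pos h, Pi.add_apply,
      Pi.single_eq_same, neg_one_pow_bit_add_one]
    rw [Finset.prod_congr rfl fun l hl => by
      rw [Pi.add_apply, Pi.single_eq_of_ne (Finset.ne_of_mem_erase hl), add_zero]]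
    ring
  · rw [if_neg h, pow_zero, one_mul]
    refine Finset.prod_congr rfl fun l hl => ?_
    have : l ≠ k := fun e => h (e ▸ (Finset.mem_filter.1 hl).2)
    rw [Pi.add_apply, Pi.single_eq_of_ne this, add_zero]

theorem majoranaPhase_flip {n : ℕ} (i : Fin n × Fin 2) (k : Fin n) (y : Bits n) :
    majoranaPhase i (y + Pi.single k 1) =
      (-1) ^ ((if k < i.1 then 1 else 0) + if i.1 = k ∧ i.2 = 1 then 1 else 0) *
        majoranaPhase i y := by
  obtain ⟨j, s⟩ := i
  simp only [majoranaPhase, stringSign_flip, Pi.add_apply]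
  by_cases hjk : j = k
  · subst hjk
    fin_cases s <;> simp [neg_one_pow_bit_add_one]
  · rw [Pi.single_eq_of_ne hjk]
    simp [hjk]

theorem stringSign_mul_self {n : ℕ} (j : Fin n) (y : Bits n) :
    stringSign j y * stringSign j y = 1 := by
  rw [stringSign, ← Finset.prod_mul_distrib]
  refine Finset.prod_eq_one fun l _ => ?_
  rw [← mul_pow]; simp

theorem star_stringSign {n : ℕ} (j : Fin n) (y : Bits n) :
    (starRingEnd ℂ) (stringSign j y) = stringSign j y := by
  simp [stringSign, map_prod]

theorem majoranaPhase_mul_self {n : ℕ} (i : Fin n × Fin 2) (y : Bits n) :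
    majoranaPhase i y * majoranaPhase i y = (-1) ^ (i.2 : ℕ) := by
  have h1 := stringSign_mul_self i.1 y
  have h2 : ((-1 : ℂ) ^ (y i.1 : ℕ)) * (-1 : ℂ) ^ (y i.1 : ℕ) = 1 := by rw [← mul_pow]; simp
  obtain ⟨j, s⟩ := i
  fin_cases s
  · simpa [majoranaPhase] using h1
  · simp only [majoranaPhase]
    simp
    linear_combination (Complex.I ^ 2 * ((-1 : ℂ) ^ (y j : ℕ)) * (-1 : ℂ) ^ (y j : ℕ)) * h1 +
      Complex.I ^ 2 * h2 + Complex.I_sq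

theorem majorana_mul_self {n : ℕ} (i : Fin n × Fin 2) : majorana i * majorana i = (1 : QOp n) := by
  rw [majorana, shiftOp_mul, bits_add_self]
  ext x y
  simp only [shiftOp, add_zero, majoranaPhase_flip, Matrix.one_apply, mul_assoc,
    majoranaPhase_mul_self]
  split_ifs <;> obtain ⟨j, s⟩ := i <;> fin_cases s <;> simp_all

theorem majorana_conjTranspose {n : ℕ} (i : Fin n × Fin 2) :
    (majorana i : QOp n).conjTranspose = majorana i := by
  ext x y
  simp only [majorana, shiftOp, Matrix.conjTranspose_apply]
  by_cases h : x = y + Pi.single i.1 1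
  · rw [if_pos h, if_pos ((bits_eq_add_iff _ _ _).1 h), h, majoranaPhase_flip]
    obtain ⟨j, s⟩ := i
    fin_cases s <;> simp [majoranaPhase, star_stringSign]
  · rw [if_neg h, if_neg (fun h' => h ((bits_eq_add_iff _ _ _).1 h')), star_zero]

theorem majorana_anticomm {n : ℕ} (i j : Fin n × Fin 2) (hij : i ≠ j) :
    majorana i * majorana j = -(majorana j * majorana i : QOp n) := by
  rw [majorana, majorana, shiftOp_sign _ _ (majoranaPhase_flip i j.1) (majoranaPhase_flip j i.1),
    Odd.neg_one_pow, neg_one_smul]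
  obtain ⟨i, s⟩ := i
  obtain ⟨j, r⟩ := j
  rw [Nat.odd_iff]
  rcases lt_trichotomy i j with h | h | h
  · simp [h, h.not_gt, h.ne, h.ne']
  · subst h
    have hsr : s ≠ r := fun e => hij (by rw [e])
    fin_cases s <;> fin_cases r <;> simp_all
  · simp [h, h.not_gt, h.ne, h.ne']

theorem majorana_pair {n : ℕ} (j : Fin n) : majorana (j, 0) * majorana (j, 1) =
    (Matrix.diagonal fun y => Complex.I * (-1) ^ (y j : ℕ) : QOp n) := by
  rw [majorana, majorana, shiftOp_mul, bits_add_self]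
  ext x y
  simp only [shiftOp, add_zero, majoranaPhase_flip, Matrix.diagonal_apply]
  by_cases h : x = y
  · subst h
    simp only [if_true, majoranaPhase]
    simp
    linear_combination (Complex.I * (-1) ^ (x j : ℕ)) * stringSign_mul_self j x
  · simp [h]

/-- Numbering of the Majorana operators by pairs of consecutive qubits. -/
def blockIndexEquiv (t : ℕ) : Fin t × Fin 4 ≃ Fin (t * 2) × Fin 2 :=
  ((Equiv.refl _).prodCongr (finProdFinEquiv : Fin 2 × Fin 2 ≃ Fin (2 * 2)).symm).trans
    ((Equiv.prodAssoc _ _ _).symm.trans (finProdFinEquiv.prodCongr (Equiv.refl _)))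

/-- The four Majorana operators of each pair of consecutive qubits. -/
noncomputable def blockMajorana (t : ℕ) (i : Fin t × Fin 4) : QOp (t * 2) :=
  majorana (blockIndexEquiv t i)

theorem blockMajorana_apply (t : ℕ) (b : Fin t) {q : Fin 4} {r s : Fin 2}
    (h : (finProdFinEquiv : Fin 2 × Fin 2 ≃ Fin (2 * 2)).symm q = (r, s)) :
    blockMajorana t (b, q) = majorana (finProdFinEquiv (b, r), s) := by
  rw [blockMajorana]
  simp only [blockIndexEquiv, Equiv.trans_apply, Equiv.prodCongr_apply, Prod.map, h]
  rfl

/-- The operator `Z ⊗ Z` on the `k`-th pair of qubits. -/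
def blockParity (t : ℕ) (b : Fin t) : QOp (t * 2) :=
  Matrix.diagonal fun y => (-1) ^ (y (finProdFinEquiv (b, 0)) : ℕ) *
    (-1) ^ (y (finProdFinEquiv (b, 1)) : ℕ)

theorem isMajoranaBlocks (t : ℕ) : IsMajoranaBlocks (blockMajorana t) (blockParity t) where
  mul_self i := majorana_mul_self _
  anticomm i j hij := by
    exact majorana_anticomm _ _ fun h => hij ((blockIndexEquiv t).injective h)
  herm i := majorana_conjTranspose _
  parity_eq b := by
    have h0 := blockMajorana_apply t b (q := 0) (r := 0) (s := 0) (by decide)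
    have h1 := blockMajorana_apply t b (q := 1) (r := 0) (s := 1) (by decide)
    have h2 := blockMajorana_apply t b (q := 2) (r := 1) (s := 0) (by decide)
    have h3 := blockMajorana_apply t b (q := 3) (r := 1) (s := 1) (by decide)
    rw [h0, h1, h2, h3, majorana_pair, mul_assoc, majorana_pair, Matrix.diagonal_mul_diagonal,
      blockParity, Matrix.diagonal_neg]
    congr 1
    funext y
    linear_combination ((-1) ^ (y (finProdFinEquiv (b, 0)) : ℕ) *
      (-1) ^ (y (finProdFinEquiv (b, 1)) : ℕ)) * Complex.I_sq

/-! ### Gaussian unitaries preserve the Majorana pairing -/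

theorem matchgate_apply (A B : Matrix (Fin 2) (Fin 2) ℂ) (a b c d : Fin 2) :
    matchgate A B ![a, b] ![c, d] =
      if a = b ∧ c = d then A a c else if a ≠ b ∧ c ≠ d then B a c else 0 := rfl

/-- A unitary `2 × 2` matrix is determined by its first column and its determinant. -/
theorem unitary_two_entries {A : Matrix (Fin 2) (Fin 2) ℂ}
    (hA : A ∈ Matrix.unitaryGroup (Fin 2) ℂ) :
    A 0 1 = -(A.det * star (A 1 0)) ∧ A 1 1 = A.det * star (A 0 0) ∧
      A 0 0 * star (A 0 0) + A 1 0 * star (A 1 0) = 1 ∧ A.det * star A.det = 1 := by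
  have h1 := Matrix.mem_unitaryGroup_iff'.1 hA
  have h00 := congrFun (congrFun h1 0) 0
  have h01 := congrFun (congrFun h1 0) 1
  simp only [Matrix.mul_apply, Fin.sum_univ_two, Matrix.star_apply, Matrix.one_apply] at h00 h01
  simp at h00 h01
  have hd : A.det * star A.det = 1 := by
    rw [← Matrix.det_conjTranspose, ← Matrix.det_mul, ← Matrix.star_eq_conjTranspose,
      Matrix.mem_unitaryGroup_iff.1 hA, Matrix.det_one]
  refine ⟨?_, ?_, ?_, hd⟩
  · rw [Matrix.det_fin_two]; simp only [Complex.star_def]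
    linear_combination (-A 0 1) * h00 + A 0 0 * h01
  · rw [Matrix.det_fin_two]; simp only [Complex.star_def]
    linear_combination (-A 1 1) * h00 + A 1 0 * h01
  · simp only [Complex.star_def]; linear_combination h00

/-- The phases of the two Majorana operators of one qubit cancel unless both labels agree on that
qubit. -/
theorem sum_majoranaPhase {n : ℕ} (q : Fin n) (y y' : Bits n) :
    ∑ s, majoranaPhase (q, s) y * star (majoranaPhase (q, s) y') =
      2 * (stringSign q y * stringSign q y' * if y q = y' q then 1 else 0) := by
  have h : ∀ u u' : Fin 2, ((-1 : ℂ) ^ (u : ℕ)) * (-1) ^ (u' : ℕ) = if u = u' then 1 else -1 := by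
    intro u u'; fin_cases u <;> fin_cases u' <;> simp
  have h2 := h (y q) (y' q)
  simp only [Fin.sum_univ_two, majoranaPhase, Complex.star_def, map_mul, star_stringSign, map_pow,
    map_neg, map_one, Complex.conj_I, if_true, one_ne_zero, if_false, mul_one]
  split_ifs at h2 ⊢
  · linear_combination (-Complex.I ^ 2 * stringSign q y * stringSign q y') * h2 -
      stringSign q y * stringSign q y' * Complex.I_sq
  · linear_combination (-Complex.I ^ 2 * stringSign q y * stringSign q y') * h2 +
      stringSign q y * stringSign q y' * Complex.I_sq

theorem sum_dbl_majorana_mul_apply {n : ℕ} (U : QOp n) (q : Fin n) (x x' y y' : Bits n) :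
    (∑ s, dbl (majorana (q, s) * U) (majorana (q, s) * U)) (x, x') (y, y') =
      2 * (stringSign q x * stringSign q x' * if x q = x' q then
        U (x + Pi.single q 1) y * star (U (x' + Pi.single q 1) y') else 0) := by
  have h := sum_majoranaPhase q (x + Pi.single q 1) (x' + Pi.single q 1)
  simp only [stringSign_flip, lt_irrefl, if_false, pow_zero, one_mul, Pi.add_apply,
    add_left_inj] at h
  simp only [Matrix.sum_apply, dbl_apply, majorana, shiftOp_mul_apply, star_mul']
  calc _ = (∑ s, majoranaPhase (q, s) (x + Pi.single q 1) *
        star (majoranaPhase (q, s) (x' + Pi.single q 1))) *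
        (U (x + Pi.single q 1) y * star (U (x' + Pi.single q 1) y')) := by
        rw [Finset.sum_mul]
        exact Finset.sum_congr rfl fun s _ => by ring
    _ = _ := by
        rw [h]
        split_ifs <;> ring

theorem sum_dbl_mul_majorana_apply {n : ℕ} (U : QOp n) (q : Fin n) (x x' y y' : Bits n) :
    (∑ s, dbl (U * majorana (q, s)) (U * majorana (q, s))) (x, x') (y, y') =
      2 * (stringSign q y * stringSign q y' * if y q = y' q then
        U x (y + Pi.single q 1) * star (U x' (y' + Pi.single q 1)) else 0) := by
  simp only [Matrix.sum_apply, dbl_apply, majorana, mul_shiftOp_apply, star_mul']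
  calc _ = (∑ s, majoranaPhase (q, s) y * star (majoranaPhase (q, s) y')) *
        (U x (y + Pi.single q 1) * star (U x' (y' + Pi.single q 1))) := by
        rw [Finset.sum_mul]
        exact Finset.sum_congr rfl fun s _ => by ring
    _ = _ := by
        rw [sum_majoranaPhase]
        split_ifs <;> ring

theorem stringSign_fin_two_zero (y : Bits 2) : stringSign 0 y = 1 := by simp [stringSign]

theorem stringSign_fin_two_one (y : Bits 2) : stringSign 1 y = (-1) ^ (y 0 : ℕ) := by
  have : Finset.univ.filter (· < (1 : Fin 2)) = {0} := by decide
  rw [stringSign, this, Finset.prod_singleton]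

theorem bits_two_eq (x : Bits 2) : ∃ a b, x = ![a, b] :=
  ⟨x 0, x 1, by funext i; fin_cases i <;> rfl⟩

/-- The block of a matchgate on the two-qubit states of a given parity. -/
theorem matchgate_apply_of_parity (A B : Matrix (Fin 2) (Fin 2) ℂ) (x0 x1 y0 y1 : Fin 2) :
    matchgate A B ![x0, x1] ![y0, y1] =
      if x0 + x1 = y0 + y1 then (if x0 + x1 = 0 then A x0 y0 else B x0 y0) else 0 := by
  rw [matchgate_apply]
  fin_cases x0 <;> fin_cases x1 <;> fin_cases y0 <;> fin_cases y1 <;> simp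

/-- Conjugation by a matchgate with equal determinants acts orthogonally on the four Majorana
operators of two qubits. The blocks that couple the even to the odd subspace need the condition
`det A = det B`; the others hold for arbitrary unitary `A` and `B`. -/
theorem pairing_matchgate {A B : Matrix (Fin 2) (Fin 2) ℂ}
    (hA : A ∈ Matrix.unitaryGroup (Fin 2) ℂ) (hB : B ∈ Matrix.unitaryGroup (Fin 2) ℂ)
    (hdet : A.det = B.det) :
    ∑ i, dbl (majorana i * matchgate A B) (majorana i * matchgate A B) =
      ∑ i, dbl (matchgate A B * majorana i) (matchgate A B * majorana i) := by
  obtain ⟨a1, a2, a3, hz⟩ := unitary_two_entries hA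
  obtain ⟨b1, b2, b3, -⟩ := unitary_two_entries hB
  rw [← hdet] at b1 b2
  generalize A.det = z at *
  have e0 : ∀ a b : Fin 2, (![a, b] + Pi.single 0 1 : Bits 2) = ![a + 1, b] := by decide
  have e1 : ∀ a b : Fin 2, (![a, b] + Pi.single 1 1 : Bits 2) = ![a, b + 1] := by decide
  -- The entrywise identity, for the only labels at which the entries can be nonzero.
  have key : ∀ x0 x1 x0' x1' y0 y1 y0' y1' : Fin 2,
      x0 + x1 ≠ y0 + y1 → x0' + x1' ≠ y0' + y1' →
      ((if x0 = x0' then (if x0 + x1 = 0 then B (x0 + 1) y0 else A (x0 + 1) y0) *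
        star (if x0' + x1' = 0 then B (x0' + 1) y0' else A (x0' + 1) y0') else 0) +
      (-1) ^ (x0 : ℕ) * (-1) ^ (x0' : ℕ) *
        (if x1 = x1' then (if x0 + x1 = 0 then B x0 y0 else A x0 y0) *
        star (if x0' + x1' = 0 then B x0' y0' else A x0' y0') else 0) =
      (if y0 = y0' then (if x0 + x1 = 0 then A x0 (y0 + 1) else B x0 (y0 + 1)) *
        star (if x0' + x1' = 0 then A x0' (y0' + 1) else B x0' (y0' + 1)) else 0) +
      (-1) ^ (y0 : ℕ) * (-1) ^ (y0' : ℕ) *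
        (if y1 = y1' then (if x0 + x1 = 0 then A x0 y0 else B x0 y0) *
        star (if x0' + x1' = 0 then A x0' y0' else B x0' y0') else 0)) := by
    have hd : ∀ u v w z : Fin 2, u + v ≠ w + z → z = w + u + v + 1 := by decide
    intro x0 x1 x0' x1' y0 y1 y0' y1' h h'
    rw [hd _ _ _ _ h, hd _ _ _ _ h']
    clear h h'
    simp only [Complex.star_def] at a3 b3 hz
    fin_cases x0 <;> fin_cases x1 <;> fin_cases y0 <;>
    fin_cases x0' <;> fin_cases x1' <;> fin_cases y0' <;> simp [a1, a2, b1, b2] <;> grind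
  ext ⟨x, x'⟩ ⟨y, y'⟩
  have hsum : ∀ F : Fin 2 × Fin 2 → Matrix (Bits 2 × Bits 2) (Bits 2 × Bits 2) ℂ,
      (∑ i, F i) (x, x') (y, y') =
        (∑ s, F (0, s)) (x, x') (y, y') + (∑ s, F (1, s)) (x, x') (y, y') := fun F => by
    rw [Fintype.sum_prod_type, Fin.sum_univ_two, Matrix.add_apply]
  rw [hsum, hsum, sum_dbl_majorana_mul_apply, sum_dbl_majorana_mul_apply,
    sum_dbl_mul_majorana_apply, sum_dbl_mul_majorana_apply]
  obtain ⟨x0, x1, rfl⟩ := bits_two_eq x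
  obtain ⟨y0, y1, rfl⟩ := bits_two_eq y
  obtain ⟨x0', x1', rfl⟩ := bits_two_eq x'
  obtain ⟨y0', y1', rfl⟩ := bits_two_eq y'
  have hp : ∀ u v w z : Fin 2, (u + 1 + v = w + z ↔ u + v ≠ w + z) ∧
      (u + (v + 1) = w + z ↔ u + v ≠ w + z) ∧ (u + v = w + 1 + z ↔ u + v ≠ w + z) ∧
      (u + v = w + (z + 1) ↔ u + v ≠ w + z) := by decide
  have hp2 : ∀ u v : Fin 2, (u + 1 + v = 0 ↔ ¬ (u + v = 0)) ∧
      (u + (v + 1) = 0 ↔ ¬ (u + v = 0)) := by decide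
  simp only [e0, e1, stringSign_fin_two_zero, stringSign_fin_two_one,
    matchgate_apply_of_parity, hp, hp2, Matrix.cons_val_zero,
    Matrix.cons_val_one]
  by_cases h : x0 + x1 = y0 + y1
  · simp [h]
  by_cases h' : x0' + x1' = y0' + y1'
  · simp [h']
  have hk := key x0 x1 x0' x1' y0 y1 y0' y1' h h'
  simp only [h, h', ne_eq, not_false_eq_true, if_true, ite_not, one_mul]
  linear_combination 2 * hk

theorem sum_dbl_onQubits {m n : ℕ} {ι : Type*} [Fintype ι] (f : Fin m → Fin n) {A B : ι → QOp m}
    (h : ∑ i, dbl (A i) (A i) = ∑ i, dbl (B i) (B i)) :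
    ∑ i, dbl (onQubits f (A i)) (onQubits f (A i)) =
      ∑ i, dbl (onQubits f (B i)) (onQubits f (B i)) := by
  ext ⟨x, x'⟩ ⟨y, y'⟩
  have h1 := congrFun (congrFun h (fun k => x (f k), fun k => x' (f k)))
    (fun k => y (f k), fun k => y' (f k))
  simp only [Matrix.sum_apply, dbl_apply, onQubits] at h1 ⊢
  split_ifs
  · exact h1
  all_goals simp

/-- Diagonal operators that depend only on the other qubits commute with `onQubits f A`. -/
theorem commute_diagonal_onQubits {m n : ℕ} {f : Fin m → Fin n} {φ : Bits n → ℂ}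
    (hφ : ∀ x y : Bits n, (∀ i, (∀ k, f k ≠ i) → x i = y i) → φ x = φ y) (A : QOp m) :
    Commute (Matrix.diagonal φ) (onQubits f A) := by
  rw [commute_iff_eq]
  ext x y
  rw [Matrix.diagonal_mul, Matrix.mul_diagonal, onQubits]
  split_ifs with h
  · rw [hφ x y h, mul_comm]
  · simp

section Neighbours

variable {n : ℕ} {j k : Fin n}

theorem injective_pair (hjk : (k : ℕ) = (j : ℕ) + 1) : Function.Injective ![j, k] := by
  have : j ≠ k := fun h => by rw [h] at hjk; omega
  intro a b h
  fin_cases a <;> fin_cases b <;> simp_all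

/-- The Majorana operators of two neighbouring qubits are those of a two-qubit system, up to the
common Jordan–Wigner string. -/
theorem majorana_eq_string_mul (hjk : (k : ℕ) = (j : ℕ) + 1) (a s : Fin 2) :
    majorana (![j, k] a, s) =
      Matrix.diagonal (stringSign j) * onQubits ![j, k] (majorana (a, s)) := by
  have hf := injective_pair hjk
  have hlt : j < k := Fin.lt_def.2 (by omega)
  ext x y
  rw [Matrix.diagonal_mul]
  have hx : x = y + Pi.single (![j, k] a) 1 ↔
      (∀ i, (∀ l, ![j, k] l ≠ i) → x i = y i) ∧
        (fun l => x (![j, k] l)) = (fun l => y (![j, k] l)) + Pi.single a 1 := by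
    constructor
    · rintro rfl
      refine ⟨fun i hi => ?_, funext fun l => ?_⟩
      · rw [Pi.add_apply, Pi.single_eq_of_ne (hi a).symm, add_zero]
      · rw [Pi.add_apply, Pi.add_apply, Pi.single_apply, Pi.single_apply]
        simp only [hf.eq_iff]
    · rintro ⟨h1, h2⟩
      funext i
      by_cases hi : ∃ l, ![j, k] l = i
      · obtain ⟨l, rfl⟩ := hi
        have := congrFun h2 l
        rw [Pi.add_apply, Pi.single_apply] at this
        rw [Pi.add_apply, Pi.single_apply, this]
        simp only [hf.eq_iff]
      · rw [h1 i (not_exists.1 hi), Pi.add_apply,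
          Pi.single_eq_of_ne fun e => hi ⟨a, e.symm⟩, add_zero]
  simp only [majorana, shiftOp, onQubits, ← ite_and]
  by_cases h : x = y + Pi.single (![j, k] a) 1
  · rw [if_pos h, if_pos (hx.1 h)]
    have hs : stringSign j x = stringSign j y := by
      rw [h, stringSign_flip, if_neg, pow_zero, one_mul]
      fin_cases a
      · simp
      · simpa using hlt.le
    rw [hs]
    have hk : stringSign k y = stringSign j y * (-1) ^ (y j : ℕ) := by
      have : Finset.univ.filter (· < k) = insert j (Finset.univ.filter (· < j)) := by
        ext l
        simp only [Finset.mem_filter, Finset.mem_univ, true_and, Finset.mem_insert, Fin.lt_def,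
          Fin.ext_iff]
        omega
      rw [stringSign, this, Finset.prod_insert (by simp), mul_comm]
      rfl
    have hstr : stringSign (![j, k] a) y =
        stringSign j y * stringSign a fun l => y (![j, k] l) := by
      fin_cases a
      · simp [stringSign_fin_two_zero]
      · simpa [stringSign_fin_two_one] using hk
    simp only [majoranaPhase, hstr, mul_assoc]
  · rw [if_neg h, if_neg fun h' => h (hx.2 h'), mul_zero]

theorem stringSign_congr (hjk : (k : ℕ) = (j : ℕ) + 1) {x y : Bits n}
    (h : ∀ i, (∀ l, ![j, k] l ≠ i) → x i = y i) : stringSign j x = stringSign j y := by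
  refine Finset.prod_congr rfl fun l hl => ?_
  rw [h l fun a e => ?_]
  have := (Finset.mem_filter.1 hl).2
  rw [Fin.lt_def] at this
  fin_cases a <;> simp at e <;> subst e <;> omega

/-- A parity-preserving gate on two neighbouring qubits commutes with the Majorana operators of all
other qubits. -/
theorem majorana_mul_matchgate (hjk : (k : ℕ) = (j : ℕ) + 1) (A B : Matrix (Fin 2) (Fin 2) ℂ)
    {q : Fin n} (hq : ∀ l, ![j, k] l ≠ q) (s : Fin 2) :
    majorana (q, s) * onQubits ![j, k] (matchgate A B) =
      onQubits ![j, k] (matchgate A B) * majorana (q, s) := by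
  have hqj : j ≠ q := hq 0
  have hqk : k ≠ q := hq 1
  ext x y
  rw [majorana, shiftOp_mul_apply, mul_shiftOp_apply, mul_comm (onQubits _ _ _ _)]
  have h1 : onQubits ![j, k] (matchgate A B) (x + Pi.single q 1) y =
      onQubits ![j, k] (matchgate A B) x (y + Pi.single q 1) := by
    have e : ∀ z : Bits n,
        (fun l => (z + Pi.single q 1 : Bits n) (![j, k] l)) = fun l => z (![j, k] l) :=
      fun z => funext fun l => by
        rw [Pi.add_apply, Pi.single_eq_of_ne (hq l), add_zero]
    have e2 : ∀ u v : Fin 2, u + 1 = v ↔ u = v + 1 := by decide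
    simp only [onQubits, e]
    refine if_congr (forall_congr' fun i => imp_congr Iff.rfl ?_) rfl rfl
    by_cases hi : i = q
    · subst hi
      simpa using e2 _ _
    · simp [Pi.single_eq_of_ne hi]
  rw [h1]
  by_cases h0 : onQubits ![j, k] (matchgate A B) x (y + Pi.single q 1) = 0
  · simp [h0]
  congr 1
  set w := y + Pi.single q 1 with hw
  have hyw : y = w + Pi.single q 1 := by rw [hw, bits_add_add_self]
  rw [hyw, majoranaPhase_flip, majoranaPhase_flip]
  congr 1
  have hxw : ∀ i, (∀ l, ![j, k] l ≠ i) → x i = w i := by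
    by_contra h
    exact h0 (if_neg h)
  rw [onQubits, if_pos hxw] at h0
  have hpar : (-1 : ℂ) ^ (x j : ℕ) * (-1) ^ (x k : ℕ) = (-1) ^ (w j : ℕ) * (-1) ^ (w k : ℕ) := by
    have h2 : matchgate A B ![x j, x k] ![w j, w k] ≠ 0 := by
      convert h0 using 2 <;> (funext l; fin_cases l <;> rfl)
    rw [matchgate_apply_of_parity] at h2
    have h3 : x j + x k = w j + w k := by
      by_contra h
      exact h2 (if_neg h)
    revert h3
    generalize x j = a; generalize x k = b; generalize w j = c; generalize w k = d
    fin_cases a <;> fin_cases b <;> fin_cases c <;> fin_cases d <;> simp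
  have hstr : stringSign q x = stringSign q w := by
    unfold stringSign
    by_cases hlt : j < q
    · have hkq : k < q := by
        rw [Fin.lt_def] at hlt ⊢
        have : (k : ℕ) ≠ q := fun e => hqk (Fin.ext e)
        omega
      have hne : k ≠ j := fun e => by rw [e] at hjk; omega
      have hjm : j ∈ Finset.univ.filter (· < q) := by simpa using hlt
      have hkm : k ∈ (Finset.univ.filter (· < q)).erase j := by simp [hne, hkq]
      rw [← Finset.mul_prod_erase _ _ hjm, ← Finset.mul_prod_erase _ _ hkm,
        ← Finset.mul_prod_erase _ (fun l => (-1 : ℂ) ^ (w l : ℕ)) hjm,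
        ← Finset.mul_prod_erase _ (fun l => (-1 : ℂ) ^ (w l : ℕ)) hkm, ← mul_assoc, ← mul_assoc,
        hpar]
      congr 1
      refine Finset.prod_congr rfl fun l hl => ?_
      rw [hxw l fun a => ?_]
      fin_cases a
      · exact (Finset.ne_of_mem_erase (Finset.mem_of_mem_erase hl)).symm
      · exact (Finset.ne_of_mem_erase hl).symm
    · refine Finset.prod_congr rfl fun l hl => ?_
      rw [hxw l fun a e => ?_]
      have := (Finset.mem_filter.1 hl).2
      rw [Fin.lt_def] at this hlt
      fin_cases a <;> simp at e <;> subst e <;> omega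
  rw [majoranaPhase, majoranaPhase, hstr, hxw q hq]

theorem pairing_onQubits_matchgate (hjk : (k : ℕ) = (j : ℕ) + 1) {A B : Matrix (Fin 2) (Fin 2) ℂ}
    (hA : A ∈ Matrix.unitaryGroup (Fin 2) ℂ) (hB : B ∈ Matrix.unitaryGroup (Fin 2) ℂ)
    (hdet : A.det = B.det) : Commute (majoranaPairing _ (majorana (n := n)))
      (dbl (onQubits ![j, k] (matchgate A B)) (onQubits ![j, k] (matchgate A B))) := by
  have hf := injective_pair hjk
  set U := onQubits ![j, k] (matchgate A B) with hU
  rw [commute_iff_eq, majoranaPairing, Finset.sum_mul, Finset.mul_sum]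
  simp only [dbl_mul]
  rw [← sub_eq_zero, ← Finset.sum_sub_distrib, Fintype.sum_prod_type]
  rw [Fintype.sum_eq_add j k (fun h => by rw [h] at hjk; omega)]
  · have hloc := sum_dbl_onQubits ![j, k] (pairing_matchgate hA hB hdet)
    have hcomm : ∀ C : QOp 2, Commute (Matrix.diagonal (stringSign j)) (onQubits ![j, k] C) :=
      commute_diagonal_onQubits fun x y h => stringSign_congr hjk h
    have e1 : ∀ a s, majorana (![j, k] a, s) * U = Matrix.diagonal (stringSign j) *
        onQubits ![j, k] (majorana (a, s) * matchgate A B) := fun a s => by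
      rw [majorana_eq_string_mul hjk, hU, mul_assoc, onQubits_mul hf]
    have e2 : ∀ a s, U * majorana (![j, k] a, s) = Matrix.diagonal (stringSign j) *
        onQubits ![j, k] (matchgate A B * majorana (a, s)) := fun a s => by
      rw [majorana_eq_string_mul hjk, hU, ← mul_assoc, ← (hcomm _).eq, mul_assoc, onQubits_mul hf]
    have h3 : ∑ a, ∑ s, (dbl (majorana (![j, k] a, s) * U) (majorana (![j, k] a, s) * U) -
        dbl (U * majorana (![j, k] a, s)) (U * majorana (![j, k] a, s))) = 0 := by
      simp only [e1, e2, ← dbl_mul (Matrix.diagonal (stringSign j))]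
      simp only [← mul_sub, ← Finset.mul_sum]
      rw [← Fintype.sum_prod_type', Finset.sum_sub_distrib, sub_eq_zero.2 hloc, mul_zero]
    rwa [Fin.sum_univ_two] at h3
  · rintro q ⟨hqj, hqk⟩
    refine Finset.sum_eq_zero fun s _ => ?_
    rw [majorana_mul_matchgate hjk A B (fun l => ?_) s, sub_self]
    fin_cases l
    · exact hqj.symm
    · exact hqk.symm

end Neighbours

theorem onQubits_oneQubit {n : ℕ} (j : Fin n) {A : Matrix (Fin 2) (Fin 2) ℂ}
    (hA : ∀ a, A a a = 0) : onQubits ![j] (oneQubit A) =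
      shiftOp (Pi.single j 1) fun y => A (y j + 1) (y j) := by
  ext x y
  have e2 : ∀ u v : Fin 2, u ≠ v → u = v + 1 := by decide
  simp only [onQubits, oneQubit, shiftOp, Fin.forall_fin_one, Matrix.cons_val_fin_one]
  by_cases h : x = y + Pi.single j 1
  · subst h
    rw [if_pos fun i hi => by rw [Pi.add_apply, Pi.single_eq_of_ne hi.symm, add_zero],
      if_pos rfl, Pi.add_apply, Pi.single_eq_same]
  · rw [if_neg h, ite_eq_right_iff]
    intro h1
    by_cases hj : x j = y j
    · rw [hj, hA]
    · refine absurd (funext fun i => ?_) h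
      by_cases hi : j = i
      · subst hi
        rw [Pi.add_apply, Pi.single_eq_same, e2 _ _ hj]
      · rw [h1 i hi, Pi.add_apply, Pi.single_eq_of_ne (Ne.symm hi), add_zero]

theorem onQubits_pauliX {n : ℕ} (j : Fin n) :
    onQubits ![j] (oneQubit pauliX) = shiftOp (Pi.single j 1) fun _ => 1 := by
  rw [onQubits_oneQubit j fun a => by fin_cases a <;> simp [pauliX]]
  congr 1
  funext y
  generalize y j = a
  fin_cases a <;> simp [pauliX]

theorem onQubits_pauliY {n : ℕ} (j : Fin n) :
    onQubits ![j] (oneQubit pauliY) =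
      shiftOp (Pi.single j 1) fun y => Complex.I * (-1) ^ (y j : ℕ) := by
  rw [onQubits_oneQubit j fun a => by fin_cases a <;> simp [pauliY]]
  congr 1
  funext y
  generalize y j = a
  fin_cases a <;> simp [pauliY]

theorem commute_pairing_of_sign {n : ℕ} {U : QOp n} (k : Fin n × Fin 2 → ℕ)
    (h : ∀ i, majorana i * U = (-1 : ℂ) ^ k i • (U * majorana i)) :
    Commute (majoranaPairing _ (majorana (n := n))) (dbl U U) :=
  Commute.sum_left _ _ _ fun i _ => commute_dbl_self (h i)

/-- Gaussian unitaries rotate the Majorana operators orthogonally, so on two copies they commute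
with the Majorana pairing. -/
theorem commute_pairing_of_mem_gaussianUnitaries {n : ℕ} {U : QOp n}
    (hU : U ∈ gaussianUnitaries n) :
    Commute (majoranaPairing _ (majorana (n := n))) (dbl U U) := by
  induction hU using Submonoid.closure_induction with
  | mem U hU =>
    rcases hU with ⟨j, k, A, B, hjk, hA, hB, hdet, rfl⟩ | ⟨j, rfl | rfl⟩
    · exact pairing_onQubits_matchgate hjk hA hB hdet
    · rw [onQubits_pauliX]
      exact commute_pairing_of_sign _ fun i =>
        shiftOp_sign _ 0 (majoranaPhase_flip i j) fun y => by simp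
    · rw [onQubits_pauliY]
      refine commute_pairing_of_sign _ fun i =>
        shiftOp_sign _ (if j = i.1 then 1 else 0) (majoranaPhase_flip i j) fun y => ?_
      by_cases h : j = i.1
      · rw [if_pos h, Pi.add_apply, h, Pi.single_eq_same, neg_one_pow_bit_add_one]
        ring
      · rw [if_neg h, Pi.add_apply, Pi.single_eq_of_ne h]
        simp
  | one => rw [dbl_one]; exact Commute.one_right _
  | mul U W _ _ hU hW => rw [← dbl_mul]; exact hU.mul_right hW

/-! ### Unitarity -/

theorem onQubits_conjTranspose {m n : ℕ} (f : Fin m → Fin n) (A : QOp m) :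
    (onQubits f A).conjTranspose = onQubits f A.conjTranspose := by
  ext x y
  simp only [Matrix.conjTranspose_apply, onQubits, apply_ite star, star_zero]
  exact if_congr (forall_congr' fun i => imp_congr Iff.rfl eq_comm) rfl rfl

theorem sum_bits_two {M : Type*} [AddCommMonoid M] (F : Bits 2 → M) :
    ∑ x, F x = F ![0, 0] + F ![0, 1] + F ![1, 0] + F ![1, 1] := by
  rw [← (finTwoArrowEquiv (Fin 2)).symm.sum_comp, Fintype.sum_prod_type]
  simp [Fin.sum_univ_two, finTwoArrowEquiv, add_assoc]

theorem matchgate_mul (A B C D : Matrix (Fin 2) (Fin 2) ℂ) :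
    matchgate A B * matchgate C D = matchgate (A * C) (B * D) := by
  ext x y
  obtain ⟨a, b, rfl⟩ := bits_two_eq x
  obtain ⟨c, d, rfl⟩ := bits_two_eq y
  simp only [Matrix.mul_apply, sum_bits_two, Fin.sum_univ_two, matchgate_apply]
  fin_cases a <;> fin_cases b <;> fin_cases c <;> fin_cases d <;> simp [add_comm]

theorem matchgate_one : matchgate 1 1 = 1 := by
  ext x y
  obtain ⟨a, b, rfl⟩ := bits_two_eq x
  obtain ⟨c, d, rfl⟩ := bits_two_eq y
  rw [matchgate_apply]
  fin_cases a <;> fin_cases b <;> fin_cases c <;> fin_cases d <;> simp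

theorem matchgate_conjTranspose (A B : Matrix (Fin 2) (Fin 2) ℂ) :
    (matchgate A B).conjTranspose = matchgate A.conjTranspose B.conjTranspose := by
  ext x y
  obtain ⟨a, b, rfl⟩ := bits_two_eq x
  obtain ⟨c, d, rfl⟩ := bits_two_eq y
  simp only [Matrix.conjTranspose_apply, matchgate_apply]
  fin_cases a <;> fin_cases b <;> fin_cases c <;> fin_cases d <;> simp

theorem matchgate_mem_gaussianUnitaries {A B : Matrix (Fin 2) (Fin 2) ℂ}
    (hA : A ∈ Matrix.unitaryGroup (Fin 2) ℂ) (hB : B ∈ Matrix.unitaryGroup (Fin 2) ℂ)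
    (hdet : A.det = B.det) : matchgate A B ∈ gaussianUnitaries 2 := by
  refine Submonoid.subset_closure (Or.inl ⟨0, 1, A, B, rfl, hA, hB, hdet, ?_⟩)
  ext x y
  obtain ⟨a, b, rfl⟩ := bits_two_eq x
  obtain ⟨c, d, rfl⟩ := bits_two_eq y
  rw [onQubits, if_pos fun i hi => ?_]
  · congr 1 <;> (funext l; fin_cases l <;> rfl)
  · fin_cases i
    · exact absurd rfl (hi 0)
    · exact absurd rfl (hi 1)

theorem shiftOp_conjTranspose_mul_self {n : ℕ} (a : Bits n) {φ : Bits n → ℂ}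
    (hφ : ∀ y, star (φ y) * φ y = 1) : (shiftOp a φ).conjTranspose * shiftOp a φ = 1 := by
  ext x y
  rw [mul_shiftOp_apply, Matrix.conjTranspose_apply, shiftOp, Matrix.one_apply]
  by_cases h : x = y
  · subst h; simpa using hφ x
  · rw [if_neg h, if_neg fun e => h (add_right_cancel e).symm, star_zero, zero_mul]

theorem conjTranspose_mul_self_of_mem_gaussianUnitaries {n : ℕ} {U : QOp n}
    (hU : U ∈ gaussianUnitaries n) : U.conjTranspose * U = 1 := by
  induction hU using Submonoid.closure_induction with
  | mem U hU =>
    rcases hU with ⟨j, k, A, B, hjk, hA, hB, hdet, rfl⟩ | ⟨j, rfl | rfl⟩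
    · rw [onQubits_conjTranspose, ← onQubits_mul (injective_pair hjk), matchgate_conjTranspose,
        matchgate_mul, ← Matrix.star_eq_conjTranspose, ← Matrix.star_eq_conjTranspose,
        Matrix.mem_unitaryGroup_iff'.1 hA, Matrix.mem_unitaryGroup_iff'.1 hB, matchgate_one,
        onQubits_one]
    · rw [onQubits_pauliX]
      exact shiftOp_conjTranspose_mul_self _ fun y => by simp
    · rw [onQubits_pauliY]
      refine shiftOp_conjTranspose_mul_self _ fun y => ?_
      generalize y j = a
      fin_cases a <;> simp
  | one => simp
  | mul U W _ _ hU hW =>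
    rw [Matrix.conjTranspose_mul, mul_assoc, ← mul_assoc _ U, hU, one_mul, hW]

/-! ### The witness for tensor powers -/

theorem list_prod_diagonal {X : Type*} [Fintype X] [DecidableEq X] {ι : Type*} (l : List ι)
    (φ : ι → X → ℂ) : (l.map fun b => Matrix.diagonal (φ b)).prod =
      Matrix.diagonal fun x => (l.map fun b => φ b x).prod := by
  induction l with
  | nil => simp
  | cons b l ih => simp [ih, Matrix.diagonal_mul_diagonal]

theorem one_sub_smul_diagonal {X : Type*} [DecidableEq X] (a : ℂ) (φ : X → ℂ) :
    1 - a • Matrix.diagonal φ = Matrix.diagonal fun x => 1 - a * φ x := by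
  ext x y
  by_cases h : x = y <;> simp [h]

theorem tensorPow_one_sub_parity (a : ℂ) (t : ℕ) :
    tensorPow (1 - a • parityOp 2) t = (List.ofFn fun b => 1 - a • blockParity t b).prod := by
  simp only [parityOp, blockParity, one_sub_smul_diagonal]
  rw [List.ofFn_eq_map, list_prod_diagonal]
  ext x y
  rw [tensorPow_eq, tensorProd_apply]
  by_cases h : x = y
  · subst h
    simp only [Matrix.diagonal_apply_eq, Fin.prod_univ_two, blockEquiv_apply]
    rw [← List.ofFn_eq_map, List.prod_ofFn]
  · rw [Matrix.diagonal_apply_ne _ h]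
    obtain ⟨k, hk⟩ := Function.ne_iff.1 fun e => h ((blockEquiv t 2).injective e)
    exact Finset.prod_eq_zero (Finset.mem_univ k) (Matrix.diagonal_apply_ne _ hk)

/-- The tensor power of `1 - i s Z ⊗ Z` with `s = ±1` has overlap at most `4 ^ t` with every
Gaussian unitary. -/
theorem norm_trace_tensorPow_witness_le {t : ℕ} {s : ℝ} (hs : s ^ 2 = 1) {K : QOp (t * 2)}
    (hK : K ∈ gaussianUnitaries (t * 2)) :
    ‖(tensorPow (1 - (Complex.I * s) • parityOp 2) t * K).trace‖ ≤ 4 ^ t := by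
  have hΛ : Commute (majoranaPairing _ (blockMajorana t)) (dbl K K) := by
    have : majoranaPairing _ (blockMajorana t) = majoranaPairing _ (majorana (n := t * 2)) :=
      (blockIndexEquiv t).sum_comp fun i => dbl (majorana i) (majorana i)
    rw [this]
    exact commute_pairing_of_mem_gaussianUnitaries hK
  rw [tensorPow_one_sub_parity]
  refine ((isMajoranaBlocks t).norm_trace_witness_mul_le hs
    (conjTranspose_mul_self_of_mem_gaussianUnitaries hK) hΛ).trans_eq ?_
  rw [Fintype.card_fun, Fintype.card_fin, Fintype.card_fin, mul_comm, pow_mul]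
  norm_num

/-! ### Two-qubit fermionic unitaries -/

theorem parityOp_two : parityOp 2 = matchgate 1 (-1) := by
  ext x y
  obtain ⟨a, b, rfl⟩ := bits_two_eq x
  obtain ⟨c, d, rfl⟩ := bits_two_eq y
  rw [matchgate_apply, parityOp, Matrix.diagonal_apply]
  fin_cases a <;> fin_cases b <;> fin_cases c <;> fin_cases d <;> simp

theorem matchgate_injective {A B C D : Matrix (Fin 2) (Fin 2) ℂ}
    (h : matchgate A B = matchgate C D) : A = C ∧ B = D := by
  constructor
  · ext a b
    simpa [matchgate_apply] using congrFun (congrFun h ![a, a]) ![b, b]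
  · ext a b
    simpa [matchgate_apply] using congrFun (congrFun h ![a, a + 1]) ![b, b + 1]

/-- A two-qubit fermionic unitary has the form `G(A, B)`, without a condition on the
determinants. -/
theorem IsFermionicUnitary.exists_matchgate {V : QOp 2} (hV : IsFermionicUnitary V) :
    ∃ A B, A ∈ Matrix.unitaryGroup (Fin 2) ℂ ∧ B ∈ Matrix.unitaryGroup (Fin 2) ℂ ∧
      V = matchgate A B := by
  obtain ⟨hU, hP⟩ := hV
  have hVAB : V = matchgate (Matrix.of fun a b => V ![a, a] ![b, b])
      (Matrix.of fun a b => V ![a, a + 1] ![b, b + 1]) := by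
    ext x y
    have h := congrFun (congrFun hP x) y
    rw [parityOp, Matrix.mul_diagonal, Matrix.diagonal_mul] at h
    obtain ⟨a, b, rfl⟩ := bits_two_eq x
    obtain ⟨c, d, rfl⟩ := bits_two_eq y
    rw [matchgate_apply]
    fin_cases a <;> fin_cases b <;> fin_cases c <;> fin_cases d <;> simp at h ⊢ <;>
      first | linear_combination h / 2 | linear_combination -h / 2
  refine ⟨_, _, ?_, ?_, hVAB⟩ <;> rw [Matrix.mem_unitaryGroup_iff]
  all_goals
    have h := Matrix.mem_unitaryGroup_iff.1 hU
    rw [hVAB, Matrix.star_eq_conjTranspose, matchgate_conjTranspose, matchgate_mul,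
      ← matchgate_one] at h
  · exact (matchgate_injective h).1
  · exact (matchgate_injective h).2

theorem smul_mem_unitaryGroup {A : Matrix (Fin 2) (Fin 2) ℂ}
    (hA : A ∈ Matrix.unitaryGroup (Fin 2) ℂ) {z : ℂ} (hz : z * star z = 1) :
    z • A ∈ Matrix.unitaryGroup (Fin 2) ℂ := by
  rw [Matrix.mem_unitaryGroup_iff, star_smul, smul_mul_smul_comm, Matrix.mem_unitaryGroup_iff.1 hA,
    hz, one_smul]

/-- Normal form of a two-qubit fermionic unitary: up to a matchgate it is
`cos θ + i sin θ Z ⊗ Z` with `|θ| ≤ π / 4`. -/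
theorem IsFermionicUnitary.exists_normalForm {V : QOp 2} (hV : IsFermionicUnitary V) :
    ∃ (θ : ℝ) (K : QOp 2), 0 ≤ Real.cos θ ∧ K ∈ gaussianUnitaries 2 ∧
      K * parityOp 2 ∈ gaussianUnitaries 2 ∧ K.conjTranspose ∈ gaussianUnitaries 2 ∧
      V = K * ((Real.cos θ : ℂ) • 1 + (Complex.I * Real.sin θ) • parityOp 2) := by
  obtain ⟨A, B, hA, hB, rfl⟩ := hV.exists_matchgate
  have hdA := (unitary_two_entries hA).2.2.2
  have hdB := (unitary_two_entries hB).2.2.2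
  -- The angle is chosen such that `exp (4 i θ)` is the ratio of the two determinants.
  set r := A.det * star B.det with hr
  set θ : ℝ := Complex.arg r / 4 with hθ
  set w : ℂ := Complex.exp (θ * Complex.I) with hw
  set w' : ℂ := Complex.exp (-(θ * Complex.I)) with hw'
  have hww' : w * w' = 1 := by rw [hw, hw', ← Complex.exp_add, add_neg_cancel, Complex.exp_zero]
  have hws : star w = w' := by
    rw [hw, hw', Complex.star_def, ← Complex.exp_conj]
    simp
  have hws' : star w' = w := by rw [← hws, star_star]
  have hnr : ‖r‖ = 1 := by
    have h1 : r * star r = 1 := by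
      rw [hr, star_mul', star_star]; linear_combination hdB + B.det * star B.det * hdA
    have h2 := congrArg norm h1
    rw [norm_mul, norm_star, norm_one, ← sq] at h2
    exact (pow_eq_one_iff_of_nonneg (norm_nonneg r) two_ne_zero).1 h2
  have hw4 : w ^ 4 = r := by
    rw [hw, ← Complex.exp_nat_mul]
    have := Complex.norm_mul_exp_arg_mul_I r
    rw [hnr, Complex.ofReal_one, one_mul] at this
    rw [← this, hθ]
    congr 1
    push_cast
    ring
  have hdet : (w' • A).det = (w • B).det := by
    rw [Matrix.det_smul, Matrix.det_smul, Fintype.card_fin]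
    have h1 : w ^ 4 * B.det = A.det := by
      rw [hw4, hr]; linear_combination A.det * hdB
    have h2 : w ^ 2 * w' ^ 2 = 1 := by rw [← mul_pow, hww', one_pow]
    rw [← h1]
    linear_combination (w ^ 2 * B.det) * h2
  have hA' := smul_mem_unitaryGroup hA (z := w') (by rw [hws', mul_comm, hww'])
  have hB' := smul_mem_unitaryGroup hB (z := w) (by rw [hws, hww'])
  refine ⟨θ, matchgate (w' • A) (w • B), ?_, matchgate_mem_gaussianUnitaries hA' hB' hdet,
    ?_, ?_, ?_⟩
  · refine Real.cos_nonneg_of_neg_pi_div_two_le_of_le ?_ ?_ <;>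
      linarith [Complex.neg_pi_lt_arg r, Complex.arg_le_pi r, Real.pi_pos]
  · rw [parityOp_two, matchgate_mul, mul_one, mul_neg_one, ← neg_smul, ← neg_one_mul w, mul_smul,
      neg_one_smul]
    refine matchgate_mem_gaussianUnitaries hA' ?_ ?_
    · have := smul_mem_unitaryGroup hB' (z := -1) (by simp)
      rwa [neg_one_smul] at this
    · rw [hdet, Matrix.det_neg]; simp
  · rw [matchgate_conjTranspose]
    refine matchgate_mem_gaussianUnitaries (Unitary.star_mem hA') (Unitary.star_mem hB') ?_
    rw [Matrix.det_conjTranspose, Matrix.det_conjTranspose, hdet]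
  · have h1 : (Real.cos θ : ℂ) • (1 : QOp 2) + (Complex.I * Real.sin θ) • parityOp 2 =
        matchgate (w • 1) (w' • 1) := by
      have e1 : w = Real.cos θ + Real.sin θ * Complex.I := by
        rw [hw, Complex.exp_mul_I, Complex.ofReal_cos, Complex.ofReal_sin]
      have e2 : w' = Real.cos θ - Real.sin θ * Complex.I := by
        rw [hw', ← neg_mul, Complex.exp_mul_I, Complex.cos_neg, Complex.sin_neg, Complex.ofReal_cos,
          Complex.ofReal_sin]
        ring
      rw [parityOp_two, ← matchgate_one]
      ext x y
      obtain ⟨a, b, rfl⟩ := bits_two_eq x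
      obtain ⟨c, d, rfl⟩ := bits_two_eq y
      simp only [Matrix.add_apply, Matrix.smul_apply, matchgate_apply, Matrix.neg_apply, e1, e2,
        smul_eq_mul]
      split_ifs <;> ring
    rw [h1, matchgate_mul]
    congr 1
    · rw [smul_mul_smul_comm, mul_one, mul_comm, hww', one_smul]
    · rw [smul_mul_smul_comm, mul_one, hww', one_smul]

theorem parityOp_two_mul_self : parityOp 2 * parityOp 2 = 1 := by
  rw [parityOp_two, matchgate_mul, ← matchgate_one]; simp

theorem trace_parityOp_two : (parityOp 2).trace = 0 := by
  simp [parityOp, Matrix.trace, sum_bits_two]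

theorem trace_witness_mul (θ s : ℝ) :
    ((1 - (Complex.I * s) • parityOp 2) *
      ((Real.cos θ : ℂ) • 1 + (Complex.I * Real.sin θ) • parityOp 2)).trace =
      4 * ((Real.cos θ + s * Real.sin θ : ℝ) : ℂ) := by
  have h1 : (1 : QOp 2).trace = 4 := by rw [Matrix.trace_one]; simp
  simp only [sub_mul, mul_add, one_mul, mul_one, smul_mul_assoc, parityOp_two_mul_self,
    mul_smul_comm, Matrix.trace_sub, Matrix.trace_add, Matrix.trace_smul, h1, trace_parityOp_two,
    smul_eq_mul]
  push_cast
  linear_combination (-4 * s * Complex.sin θ) * Complex.I_sq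

/-- The extents of the tensor powers of a two-qubit fermionic unitary are the powers of one
number. -/
theorem IsFermionicUnitary.exists_extent {V : QOp 2} (hV : IsFermionicUnitary V) :
    ∃ μ : ℝ, unitaryExtent V = μ ∧ ∀ t, unitaryExtent (tensorPow V t) = μ ^ t := by
  obtain ⟨θ, K, hcos, hK, hKP, hKH, hVK⟩ := hV.exists_normalForm
  obtain ⟨s, hs, hsin⟩ : ∃ s : ℝ, s ^ 2 = 1 ∧ s * Real.sin θ = |Real.sin θ| := by
    rcases le_total 0 (Real.sin θ) with h | h
    · exact ⟨1, by norm_num, by rw [one_mul, abs_of_nonneg h]⟩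
    · exact ⟨-1, by norm_num, by rw [neg_one_mul, abs_of_nonpos h]⟩
  set D : QOp 2 := (Real.cos θ : ℂ) • 1 + (Complex.I * Real.sin θ) • parityOp 2 with hD
  set m : ℝ := Real.cos θ + |Real.sin θ| with hm
  have hm0 : 0 ≤ m := add_nonneg hcos (abs_nonneg _)
  -- Decomposition of `V` into two Gaussian unitaries with the weight `m`.
  let c' : Fin 2 → ℂ := ![(Real.cos θ : ℂ), Complex.I * Real.sin θ]
  let K' : Fin 2 → QOp 2 := ![K, K * parityOp 2]
  have hK' : ∀ j, K' j ∈ gaussianUnitaries 2 := fun j => by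
    fin_cases j
    · exact hK
    · exact hKP
  have hV' : V = ∑ j, c' j • K' j := by
    rw [hVK, hD, Fin.sum_univ_two, mul_add, mul_smul_comm, mul_smul_comm, mul_one]
    rfl
  have hc' : ∑ j, ‖c' j‖ = m := by
    rw [Fin.sum_univ_two]
    simp only [c', Matrix.cons_val_zero, Matrix.cons_val_one, norm_mul, Complex.norm_I, one_mul,
      Complex.norm_real, Real.norm_eq_abs, abs_of_nonneg hcos, hm]
  -- The tensor power of the witness shows that no decomposition has a smaller weight.
  have hlow : ∀ (t χ : ℕ) (c : Fin χ → ℂ) (L : Fin χ → QOp (t * 2)),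
      (∀ j, L j ∈ gaussianUnitaries (t * 2)) → tensorPow V t = ∑ j, c j • L j →
      m ^ t ≤ ∑ j, ‖c j‖ := by
    intro t χ c L hL hdec
    set W := tensorPow (1 - (Complex.I * s) • parityOp 2) t with hW
    have hKV : K.conjTranspose * V = D := by
      rw [hVK, ← mul_assoc, conjTranspose_mul_self_of_mem_gaussianUnitaries hK, one_mul]
    have h1 : (W * tensorPow D t).trace = ((4 * m : ℝ) : ℂ) ^ t := by
      rw [hW, ← tensorPow_mul, trace_tensorPow, trace_witness_mul, hsin, ← hm]
      push_cast
      rfl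
    have h2 : W * tensorPow D t =
        ∑ j, c j • (W * (tensorPow K.conjTranspose t * L j)) := by
      rw [← hKV, tensorPow_mul, hdec, Finset.mul_sum, Finset.mul_sum]
      simp only [mul_smul_comm]
    have h3 : (4 * m) ^ t ≤ ∑ j, ‖c j‖ * 4 ^ t := by
      calc (4 * m) ^ t = ‖(W * tensorPow D t).trace‖ := by
            rw [h1, norm_pow, Complex.norm_real, Real.norm_of_nonneg (by positivity)]
        _ ≤ ∑ j, ‖c j‖ * 4 ^ t := by
            rw [h2, Matrix.trace_sum]
            refine (norm_sum_le _ _).trans (Finset.sum_le_sum fun j _ => ?_)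
            rw [Matrix.trace_smul, norm_smul]
            exact mul_le_mul_of_nonneg_left (norm_trace_tensorPow_witness_le hs
              (mul_mem (tensorProd_mem_gaussianUnitaries fun _ => hKH) (hL j))) (norm_nonneg _)
    rw [← Finset.sum_mul, mul_pow, mul_comm] at h3
    exact le_of_mul_le_mul_right h3 (by positivity)
  have ht : ∀ t, unitaryExtent (tensorPow V t) = (m ^ 2) ^ t := by
    intro t
    refine le_antisymm ?_ ?_
    · have := unitaryExtent_tensorPow_le c' K' hK' hV' t
      rwa [hc', pow_mul] at this
    · refine le_csInf ?_ ?_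
      · obtain ⟨χ, c, L, hL, hdec, -⟩ := exists_decomposition_tensorPow c' K' hK' hV' t
        exact ⟨_, χ, c, L, hL, hdec, rfl⟩
      · rintro r ⟨χ, c, L, hL, hdec, rfl⟩
        rw [← pow_mul, mul_comm, pow_mul]
        exact pow_le_pow_left₀ (pow_nonneg hm0 t) (hlow t χ c L hL hdec) 2
  refine ⟨m ^ 2, le_antisymm ?_ ?_, ht⟩
  · have := unitaryExtent_le c' K' hK' hV'
    rwa [hc'] at this
  · refine le_csInf ⟨_, 2, c', K', hK', hV', rfl⟩ ?_
    rintro r ⟨χ, c, L, hL, hdec, rfl⟩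
    have := unitaryExtent_tensorPow_le c L hL hdec 1
    rwa [ht, pow_one, mul_one] at this

/-! ### Choi states -/

theorem bits_four_ext {x y : Bits 4} (h0 : x 0 = y 0) (h1 : x 1 = y 1) (h2 : x 2 = y 2)
    (h3 : x 3 = y 3) : x = y := by
  funext i; fin_cases i <;> assumption

/-- The entries of an operator are, up to a factor, the amplitudes of its Choi state. -/
theorem choiState_apply (W : QOp 2) (x : Bits 4) :
    choiState W x = W ![x 1, x 2] ![x 0, x 3] / 2 := by
  have hs : ((Real.sqrt 2 : ℝ) : ℂ) * (Real.sqrt 2 : ℝ) = 2 := by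
    rw [← Complex.ofReal_mul, Real.mul_self_sqrt (by norm_num)]; norm_num
  have hs0 : ((Real.sqrt 2 : ℝ) : ℂ) ≠ 0 := fun h => by rw [h] at hs; norm_num at hs
  have hpair : ∀ a b c d : Fin 2, (fun k => (![a, b, c, d] : Bits 4) (![1, 2] k)) = ![b, c] :=
    fun a b c d => by funext k; fin_cases k <;> rfl
  have hpair' : ∀ y : Bits 4, (fun k => y (![1, 2] k)) = ![y 1, y 2] :=
    fun y => by funext k; fin_cases k <;> rfl
  -- The maximally entangled pairs select a single basis label of the input.
  rw [choiState, Matrix.mulVec, dotProduct, Finset.sum_eq_single ![x 0, x 0, x 3, x 3]]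
  · have h1 : ∀ i, (∀ k, (![1, 2] : Fin 2 → Fin 4) k ≠ i) →
        x i = (![x 0, x 0, x 3, x 3] : Bits 4) i := by
      intro i hi
      fin_cases i
      · rfl
      · exact absurd rfl (hi 0)
      · exact absurd rfl (hi 1)
      · rfl
    rw [onQubits, if_pos h1, hpair, hpair']
    simp [psiPlusPair, psiPlus]
    field_simp
    rw [sq, hs]
  · intro y _ hy
    by_cases h : ∀ i, (∀ k, (![1, 2] : Fin 2 → Fin 4) k ≠ i) → x i = y i
    · have h0 := h 0 (by decide)
      have h3 := h 3 (by decide)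
      by_cases h01 : y 0 = y 1
      · by_cases h23 : y 2 = y 3
        · exact absurd (bits_four_ext (y := ![x 0, x 0, x 3, x 3]) h0.symm
            (h01.symm.trans h0.symm) (h23.trans h3.symm) h3.symm) hy
        · simp [psiPlusPair, psiPlus, h23]
      · simp [psiPlusPair, psiPlus, h01]
    · rw [onQubits, if_neg h, zero_mul]
  · simp

theorem choiState_injective {V W : QOp 2} (h : choiState V = choiState W) : V = W := by
  ext x y
  obtain ⟨a, b, rfl⟩ := bits_two_eq x
  obtain ⟨c, d, rfl⟩ := bits_two_eq y
  have h1 := congrFun h ![c, a, b, d]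
  rw [choiState_apply, choiState_apply] at h1
  exact (div_left_inj' two_ne_zero).1 h1

theorem choiState_sum {ι : Type*} [Fintype ι] (c : ι → ℂ) (K : ι → QOp 2) :
    choiState (∑ j, c j • K j) = ∑ j, c j • choiState (K j) := by
  funext x
  simp only [choiState_apply, Matrix.sum_apply, Matrix.smul_apply, Finset.sum_apply, Pi.smul_apply,
    smul_eq_mul, Finset.sum_div, mul_div_assoc]

/-- The matchgate that prepares `|ψ⁺⟩` from `|00⟩`. -/
noncomputable def pairGate : QOp 2 :=
  matchgate !![1 / (Real.sqrt 2 : ℂ), -(1 / (Real.sqrt 2 : ℂ)); 1 / (Real.sqrt 2 : ℂ),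
    1 / (Real.sqrt 2 : ℂ)] 1

theorem pairGate_mem : pairGate ∈ gaussianUnitaries 2 := by
  have hs : (1 / ((Real.sqrt 2 : ℝ) : ℂ)) * (1 / ((Real.sqrt 2 : ℝ) : ℂ)) = 1 / 2 := by
    rw [div_mul_div_comm, ← Complex.ofReal_mul, Real.mul_self_sqrt (by norm_num)]; norm_num
  have hc : (starRingEnd ℂ) (1 / ((Real.sqrt 2 : ℝ) : ℂ)) = 1 / ((Real.sqrt 2 : ℝ) : ℂ) := by
    simp
  rw [pairGate]
  generalize 1 / ((Real.sqrt 2 : ℝ) : ℂ) = r at *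
  refine matchgate_mem_gaussianUnitaries ?_ (one_mem _) ?_
  · rw [Matrix.mem_unitaryGroup_iff]
    ext i j
    rw [Matrix.mul_apply, Fin.sum_univ_two]
    simp only [Matrix.star_apply, Complex.star_def]
    fin_cases i <;> fin_cases j <;> simp [hc, hs] <;> norm_num
  · rw [Matrix.det_fin_two_of, Matrix.det_one]
    linear_combination 2 * hs

theorem psiPlusPair_mem_gaussianStates : psiPlusPair ∈ gaussianStates 4 := by
  refine ⟨tensorProd 2 2 fun _ => pairGate,
    tensorProd_mem_gaussianUnitaries (t := 2) (m := 2) fun _ => pairGate_mem, ?_⟩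
  funext x
  have h1 : ((tensorProd 2 2 fun _ => pairGate : QOp 4).mulVec (zeroState 4)) x =
      (tensorProd 2 2 fun _ => pairGate : QOp 4) x 0 := by
    rw [Matrix.mulVec, dotProduct, Finset.sum_eq_single 0]
    · simp [zeroState]
    · intro y _ hy
      simp [zeroState, hy]
    · simp
  have hb0 : blockEquiv 2 2 x 0 = ![x 0, x 1] := by funext i; fin_cases i <;> rfl
  have hb1 : blockEquiv 2 2 x 1 = ![x 2, x 3] := by funext i; fin_cases i <;> rfl
  have hz : ∀ k, blockEquiv 2 2 (0 : Bits 4) k = ![0, 0] := fun k => by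
    funext i; fin_cases i <;> rfl
  have hg : ∀ a b : Fin 2, pairGate ![a, b] ![0, 0] = psiPlus ![a, b] := fun a b => by
    rw [pairGate, matchgate_apply, psiPlus]
    fin_cases a <;> fin_cases b <;> simp
  refine Eq.trans ?_ h1.symm
  refine Eq.trans ?_ (tensorProd_apply (t := 2) (m := 2) _ x 0).symm
  rw [Fin.prod_univ_two, hb0, hb1, hz, hz, hg, hg]
  rfl

theorem choiState_mem_gaussianStates {K : QOp 2} (hK : K ∈ gaussianUnitaries 2) :
    choiState K ∈ gaussianStates 4 := by
  obtain ⟨U, hU, h⟩ := psiPlusPair_mem_gaussianStates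
  refine ⟨onQubits ![1, 2] K * U, mul_mem (onQubits_mem_gaussianUnitaries (d := 1) ?_ hK) hU, ?_⟩
  · intro i; fin_cases i <;> rfl
  · rw [choiState, h, Matrix.mulVec_mulVec]

theorem stateExtent_choiState_le {χ : ℕ} {V : QOp 2} (c : Fin χ → ℂ) (K : Fin χ → QOp 2)
    (hK : ∀ j, K j ∈ gaussianUnitaries 2) (hV : V = ∑ j, c j • K j) :
    stateExtent (choiState V) ≤ (∑ j, ‖c j‖) ^ 2 := by
  refine csInf_le ⟨0, ?_⟩ ⟨χ, c, fun j => choiState (K j),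
    fun j => choiState_mem_gaussianStates (hK j), by rw [hV, choiState_sum], rfl⟩
  rintro r ⟨χ, c, φ, -, -, rfl⟩
  positivity

end FermionicExtent

/-! ### Extents of a unitary and of its Choi state -/

theorem mainTheorem2
    (V : FermionicExtent.QOp 2) (hV : FermionicExtent.IsFermionicUnitary V)
    (χ : ℕ) (c : Fin χ → ℂ) (K : Fin χ → FermionicExtent.QOp 2)
    (hK : ∀ j, K j ∈ FermionicExtent.gaussianUnitaries 2)
    (hdec : FermionicExtent.choiState V = ∑ j, c j • FermionicExtent.choiState (K j)) :
    (V = ∑ j, c j • K j ∧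
      ∀ t : ℕ,
        FermionicExtent.tensorPow V t = FermionicExtent.tensorPow (∑ j, c j • K j) t ∧
        FermionicExtent.unitaryExtent (FermionicExtent.tensorPow V t)
          ≤ (∑ j, ‖c j‖) ^ (2 * t)) ∧
    (FermionicExtent.stateExtent (FermionicExtent.choiState V) = (∑ j, ‖c j‖) ^ 2 →
      FermionicExtent.unitaryExtent V
          = FermionicExtent.stateExtent (FermionicExtent.choiState V) ∧
      ∀ t : ℕ,
        FermionicExtent.unitaryExtent (FermionicExtent.tensorPow V t)
          = FermionicExtent.unitaryExtent V ^ t) := by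
  have hVK : V = ∑ j, c j • K j := FermionicExtent.choiState_injective <| by
    rw [hdec, FermionicExtent.choiState_sum]
  refine ⟨⟨hVK, fun t => ⟨congrArg (FermionicExtent.tensorPow · t) hVK,
    FermionicExtent.unitaryExtent_tensorPow_le c K hK hVK t⟩⟩, fun hopt => ⟨le_antisymm ?_ ?_, ?_⟩⟩
  · rw [hopt]
    exact FermionicExtent.unitaryExtent_le c K hK hVK
  · refine le_csInf ⟨_, χ, c, K, hK, hVK, rfl⟩ ?_
    rintro r ⟨χ', c', K', hK', hV', rfl⟩
    exact FermionicExtent.stateExtent_choiState_le c' K' hK' hV'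
  · obtain ⟨μ, hμ, hpow⟩ := hV.exists_extent
    rw [hμ]
    exact hpow
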